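/- Conventions. Let $\mathbb F$ be a field. A cell complex is a finite set $K$ of cells with dimensions $\dim\sigma\in\mathbb Z_{\ge 0}$ and an incidence function $\kappa:K\times K\to\mathbb F$ such that $\kappa(\tau,\sigma)\neq 0$ implies $\dim\tau=\dim\sigma+1$, and $\sum_{\rho}\kappa(\tau,\rho)\kappa(\rho,\sigma)=0$ for all $\tau,\sigma$. If $\kappa(\tau,\sigma)\ne0$ then $\sigma$ is a facet of $\tau$. A subcomplex is a set of cells closed under taking facets; $H_q$ denotes the homology, with coefficients in $\mathbb F$, of the chain complex with boundary $\partial\tau=\sum_\sigma\kappa(\tau,\sigma)\sigma$, and $H_q(B,A)$ the relative homology of subcomplexes $A\subseteq B$. A bi-filtration of $K$ is a family $(K^u)_{u\in\mathbb Z^2}$ of subcomplexes with $K^u\subseteq K^v$ for $u\preceq v$ (componentwise order), for which there are $a,b\in\mathbb Z^2$ with $K^u=\emptyset$ unless $a\preceq u$ and with $K^u=K$ for $u\succeq b$, and which is one-critical: every cell lies in $K^u\setminus(K^{u-e_1}\cup K^{u-e_2})$ for exactly one $u$. A discrete vector field $V$ on $K$ is a set of pairs $(\sigma,\tau)$, with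 $\sigma$ a facet of $\tau$, such that every cell is in at most one pair; cells in no pair are critical. It is a discrete gradient if it has no closed $V$-path $\sigma_0,\tau_0,\sigma_1,\dots,\tau_{r-1},\sigma_r=\sigma_0$, where $r\ge1$, $(\sigma_i,\tau_i)\in V$ and $\sigma_{i+1}\neq\sigma_i$ is a facet of $\tau_i$. It is consistent with the bi-filtration if $\sigma\in K^u\Leftrightarrow\tau\in K^u$ for all $(\sigma,\tau)\in V$ and all $u$. The Morse number $m_q(u)$ is the number of critical cells of dimension $q$ in $K^u\setminus(K^{u-e_1}\cup K^{u-e_2})$, and $V$ is relative-perfect if $m_q(u)=\dim H_q(K^u,K^{u-e_1}\cup K^{u-e_2})$ for all $q\in\mathbb Z$ and $u\in\mathbb Z^2$. The Betti tables are $\xi_i^q(u)=\dim_{\mathbb F}\operatorname{Tor}_i^{\mathbb F[x_1,x_2]}(\mathbb V^q,\mathbb F)_u$, where $\mathbb V^q=\bigoplus_u H_q(K^u)$ is the $\mathbb Z^2$-graded module on which $x_i$ acts by the maps $H_q(K^{u-e_i})\to H_q(K^u)$ induced by inclusion. Statement. Let $V$ be a discrete gradient on a cell complex $K$ that is consistent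 with a bi-filtration of $K$. For all $u\in\mathbb Z^2$ and $q\in\mathbb Z$, $$m_q(u)\ \ge\ \xi_0^q(u)+\xi_1^{q-1}(u)-\xi_2^{q-1}(u).$$ If moreover $V$ is relative-perfect, then for all $u\in\mathbb Z^2$ and $q\in\mathbb Z$, $$m_q(u)\ \le\ \xi_0^q(u)+\xi_1^{q-1}(u)+\xi_2^{q-2}(u).$$ Both inequalities are sharp over every field $\mathbb F$: there are a consistent discrete gradient, a $u$ and a $q$ with equality in the first one and $\xi_2^{q-1}(u)\neq0$; and there are a consistent relative-perfect discrete gradient, a $u$ and a $q$ with equality in the second one and $\xi_2^{q-2}(u)\ne0$. -/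

import Mathlib

open CategoryTheory

universe u v w

/-! ## Filtration grades -/

/-- The set `ℤⁿ` of filtration grades, with the componentwise order. -/
def Grade (n : ℕ) : Type := Fin n → ℤ

namespace Grade

instance (n : ℕ) : PartialOrder (Grade n) := inferInstanceAs (PartialOrder (Fin n → ℤ))

instance (n : ℕ) : AddCommGroup (Grade n) := inferInstanceAs (AddCommGroup (Fin n → ℤ))

instance (n : ℕ) : IsOrderedAddMonoid (Grade n) :=
  inferInstanceAs (IsOrderedAddMonoid (Fin n → ℤ))

/-- The `i`-th standard basis vector of `ℤⁿ`. -/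
def e {n : ℕ} (i : Fin n) : Grade n := (Pi.single i 1 : Fin n → ℤ)

lemma sub_e_le {n : ℕ} (u : Grade n) (i : Fin n) : u - e i ≤ u :=
  sub_le_self u (show (0 : Fin n → ℤ) ≤ Pi.single i 1 from Pi.single_nonneg.2 zero_le_one)

end Grade

/-! ## Cell complexes, subcomplexes and their homology -/

/-- A (finite, Lefschetz) cell complex with incidence coefficients in the field `F`. The set `K_q` of
cells of dimension `q` is `{σ | dim σ = q}`. -/
structure CellComplex (F : Type u) [Field F] where
  /-- the cells -/
  Cell : Type v
  [fintype : Fintype Cell]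
  /-- the dimension of a cell -/
  dim : Cell → ℤ
  dim_nonneg : ∀ σ, 0 ≤ dim σ
  /-- the incidence function `κ(τ, σ)` -/
  incidence : Cell → Cell → F
  dim_of_incidence : ∀ τ σ, incidence τ σ ≠ 0 → dim τ = dim σ + 1
  sum_incidence : ∀ τ σ, ∑ ρ, incidence τ ρ * incidence ρ σ = 0

attribute [instance] CellComplex.fintype

namespace CellComplex

variable {F : Type u} [Field F] (K : CellComplex.{u, v} F)

/-- `σ` is a facet of `τ`. -/
def IsFacet (σ τ : K.Cell) : Prop := K.incidence τ σ ≠ 0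

/-- A subcomplex of `K`: a set of cells containing every facet of each of its cells, so that the
inclusion of the chains is a chain map. -/
@[ext]
structure Subcomplex where
  /-- the set of cells of the subcomplex -/
  cells : Set K.Cell
  facet_mem : ∀ ⦃σ τ⦄, K.IsFacet σ τ → τ ∈ cells → σ ∈ cells

variable {K}

namespace Subcomplex

instance : PartialOrder K.Subcomplex := PartialOrder.lift cells fun _ _ => Subcomplex.ext

/-- The union of a family of subcomplexes. -/
def iUnion {ι : Type w} (A : ι → K.Subcomplex) : K.Subcomplex where
  cells := ⋃ i, (A i).cells
  facet_mem := by
    intro σ τ h hτ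
    obtain ⟨i, hi⟩ := Set.mem_iUnion.1 hτ
    exact Set.mem_iUnion.2 ⟨i, (A i).facet_mem h hi⟩

/-- The cells of dimension `q` of the subcomplex. -/
abbrev CellsOfDim (A : K.Subcomplex) (q : ℤ) : Type v := {σ : K.Cell // σ ∈ A.cells ∧ K.dim σ = q}

/-- The linear map with matrix `κ` from `C_i(A)` to `C_j(A)`: for `j = i - 1` it is the boundary map
`∂_i(τ) = ∑_σ κ(τ, σ) σ`, and otherwise it is zero. -/
noncomputable def boundary (A : K.Subcomplex) (i j : ℤ) :
    (A.CellsOfDim i →₀ F) →ₗ[F] (A.CellsOfDim j →₀ F) :=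
  Finsupp.linearCombination F fun τ => Finsupp.equivFunOnFinite.symm fun σ => K.incidence τ σ

lemma boundary_single_apply (A : K.Subcomplex) (i j : ℤ) (τ : A.CellsOfDim i) (a : F)
    (σ : A.CellsOfDim j) :
    A.boundary i j (Finsupp.single τ a) σ = a * K.incidence τ σ := by
  simp [boundary]

lemma boundary_apply (A : K.Subcomplex) (i j : ℤ) (c : A.CellsOfDim i →₀ F) (σ : A.CellsOfDim j) :
    A.boundary i j c σ = c.sum fun τ a => a * K.incidence τ σ := by
  simp [boundary, Finsupp.linearCombination_apply, Finsupp.sum, Finsupp.finsetSum_apply]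

lemma boundary_eq_zero (A : K.Subcomplex) {i j : ℤ} (h : i ≠ j + 1) : A.boundary i j = 0 := by
  refine Finsupp.lhom_ext fun τ a => Finsupp.ext fun σ => ?_
  rw [boundary_single_apply]
  by_contra hne
  have hκ : K.incidence τ σ ≠ 0 := fun h0 => hne (by simp [h0])
  have := K.dim_of_incidence _ _ hκ
  rw [τ.2.2, σ.2.2] at this
  exact h this

lemma boundary_comp (A : K.Subcomplex) (i j k : ℤ) (hij : j + 1 = i) :
    A.boundary j k ∘ₗ A.boundary i j = 0 := by
  classical
  refine Finsupp.lhom_ext fun τ a => Finsupp.ext fun σ => ?_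
  rw [LinearMap.comp_apply, boundary_apply,
    Finsupp.sum_fintype _ _ (by simp)]
  simp only [boundary_single_apply, mul_assoc, LinearMap.zero_apply, Finsupp.zero_apply]
  rw [← Finset.mul_sum]
  have key : ∑ ρ : A.CellsOfDim j, K.incidence τ ρ * K.incidence ρ σ =
      ∑ ρ : K.Cell, K.incidence τ ρ * K.incidence ρ σ := by
    rw [← Finset.sum_subset (Finset.subset_univ
      (Finset.univ.filter fun ρ : K.Cell => ρ ∈ A.cells ∧ K.dim ρ = j))]
    · exact (Finset.sum_subtype _ (by simp) fun ρ => K.incidence τ ρ * K.incidence ρ σ).symm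
    · intro ρ _ hρ
      by_contra hne
      have h1 : K.incidence τ ρ ≠ 0 := fun h0 => hne (by simp [h0])
      have h2 := K.dim_of_incidence _ _ h1
      rw [τ.2.2] at h2
      exact hρ (by simpa using ⟨A.facet_mem h1 τ.2.1, by omega⟩)
  rw [key, K.sum_incidence, mul_zero]

/-- The chain complex `C_*(A)` of a subcomplex. -/
noncomputable def chains (A : K.Subcomplex) : ChainComplex (ModuleCat.{max u v} F) ℤ where
  X q := ModuleCat.of F (A.CellsOfDim q →₀ F)
  d i j := ModuleCat.ofHom (A.boundary i j)
  shape i j h := by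
    rw [A.boundary_eq_zero (fun h' => h h'.symm)]
    rfl
  d_comp_d' i j k hij _ := by
    rw [← ModuleCat.ofHom_comp, A.boundary_comp i j k hij]
    rfl

/-- The inclusion `C_q(A) → C_q(B)` of chains for `A ⊆ B`. -/
noncomputable def inclusion {A B : K.Subcomplex} (h : A ≤ B) (q : ℤ) :
    (A.CellsOfDim q →₀ F) →ₗ[F] (B.CellsOfDim q →₀ F) :=
  Finsupp.lmapDomain F F fun σ => ⟨σ.1, h σ.2.1, σ.2.2⟩

lemma boundary_inclusion {A B : K.Subcomplex} (h : A ≤ B) (i j : ℤ) :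
    B.boundary i j ∘ₗ inclusion h i = inclusion h j ∘ₗ A.boundary i j := by
  classical
  refine Finsupp.lhom_ext fun τ a => Finsupp.ext fun σ => ?_
  simp only [LinearMap.comp_apply, inclusion, Finsupp.lmapDomain_apply, Finsupp.mapDomain_single,
    boundary_single_apply]
  set f : A.CellsOfDim j → B.CellsOfDim j := fun σ => ⟨σ.1, h σ.2.1, σ.2.2⟩ with hf
  have hinj : Function.Injective f := fun x y hxy => Subtype.ext (congrArg (fun z => z.1) hxy)
  by_cases hσ : σ.1 ∈ A.cells
  · have : σ = f ⟨σ.1, hσ, σ.2.2⟩ := rfl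
    rw [this, Finsupp.mapDomain_apply hinj, boundary_single_apply]
  · rw [Finsupp.mapDomain_of_notMem_range]
    · by_contra hne
      have hκ : K.incidence τ σ ≠ 0 := fun h0 => hne (by simp [h0])
      exact hσ (A.facet_mem hκ τ.2.1)
    · rintro ⟨ρ, rfl⟩
      exact hσ ρ.2.1

/-- The chain map `C_*(A) → C_*(B)` induced by an inclusion `A ⊆ B`. -/
noncomputable def chainsMap {A B : K.Subcomplex} (h : A ≤ B) : A.chains ⟶ B.chains where
  f q := ModuleCat.ofHom (inclusion h q)
  comm' i j _ := by
    change ModuleCat.ofHom _ ≫ ModuleCat.ofHom _ = ModuleCat.ofHom _ ≫ ModuleCat.ofHom _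
    rw [← ModuleCat.ofHom_comp, ← ModuleCat.ofHom_comp, boundary_inclusion]

/-- `A ↦ C_*(A)` as a functor on the poset of subcomplexes. -/
noncomputable def chainsFunctor (K : CellComplex.{u, v} F) :
    K.Subcomplex ⥤ ChainComplex (ModuleCat.{max u v} F) ℤ where
  obj A := A.chains
  map f := chainsMap (leOfHom f)
  map_id A := by
    refine HomologicalComplex.hom_ext _ _ fun q => ModuleCat.hom_ext ?_
    refine Finsupp.lhom_ext (R := F) (M := F) (α := A.CellsOfDim q) fun τ a => ?_
    exact Finsupp.mapDomain_single
  map_comp {A B C} f g := by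
    refine HomologicalComplex.hom_ext _ _ fun q => ModuleCat.hom_ext ?_
    refine Finsupp.lhom_ext (R := F) (M := F) (α := A.CellsOfDim q) fun τ a => ?_
    change Finsupp.mapDomain _ _ = Finsupp.mapDomain _ (Finsupp.mapDomain _ _)
    simp only [Finsupp.mapDomain_single]

/-- The relative homology `H_q(B, A)` of a pair of subcomplexes `A ⊆ B`: the homology of
`C_*(B) / C_*(A)`. -/
noncomputable def relativeHomology {A B : K.Subcomplex} (h : A ≤ B) (q : ℤ) :
    ModuleCat.{max u v} F :=
  (Limits.cokernel (chainsMap h)).homology q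

end Subcomplex

/-! ## Multi-filtrations -/

/-- A one-critical `n`-filtration of the cell complex `K`. -/
structure MultiFiltration (K : CellComplex.{u, v} F) (n : ℕ) where
  /-- the subcomplex `K^u` of grade `u` -/
  sub : Grade n → K.Subcomplex
  monotone : Monotone sub
  /-- the grades of the cells are bounded below -/
  empty : ∃ a : Grade n, ∀ u, ¬ a ≤ u → (sub u).cells = ∅
  /-- `K^u = K` for all sufficiently large `u` -/
  full : ∃ b : Grade n, ∀ u, b ≤ u → (sub u).cells = Set.univ
  /-- each cell enters at one and only one grade -/
  oneCritical : ∀ σ : K.Cell, ∃! u : Grade n,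
    σ ∈ (sub u).cells ∧ ∀ i, σ ∉ (sub (u - Grade.e i)).cells

namespace MultiFiltration

variable {n : ℕ} (𝒦 : K.MultiFiltration n)

/-- The subcomplex `⋃ᵢ K^{u - eᵢ}`. -/
def previous (u : Grade n) : K.Subcomplex :=
  Subcomplex.iUnion fun i => 𝒦.sub (u - Grade.e i)

lemma previous_le (u : Grade n) : 𝒦.previous u ≤ 𝒦.sub u :=
  Set.iUnion_subset fun i => 𝒦.monotone (Grade.sub_e_le u i)

/-- The persistence module `u ↦ H_q(K^u)`, with the maps induced by inclusions. -/
noncomputable def persistentHomology (q : ℤ) : Grade n ⥤ ModuleCat.{max u v} F :=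
  𝒦.monotone.functor ⋙ Subcomplex.chainsFunctor K ⋙
    HomologicalComplex.homologyFunctor (ModuleCat.{max u v} F) (ComplexShape.down ℤ) q

/-- The relative homology `H_q(K^u, ⋃ᵢ K^{u - eᵢ})`. -/
noncomputable def relHomology (q : ℤ) (u : Grade n) : ModuleCat.{max u v} F :=
  Subcomplex.relativeHomology (𝒦.previous_le u) q

end MultiFiltration

/-! ## Discrete vector fields -/

/-- A discrete vector field: a set of pairs `(σ, τ)` with `σ` a facet of `τ`, such that each cell of
`K` belongs to at most one pair. -/
structure DiscreteVectorField (K : CellComplex.{u, v} F) where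
  /-- the set of discrete vectors `(σ, τ)` -/
  pairs : Set (K.Cell × K.Cell)
  isFacet : ∀ σ τ, (σ, τ) ∈ pairs → K.IsFacet σ τ
  eq_of_fst : ∀ σ τ τ', (σ, τ) ∈ pairs → (σ, τ') ∈ pairs → τ = τ'
  eq_of_snd : ∀ σ σ' τ, (σ, τ) ∈ pairs → (σ', τ) ∈ pairs → σ = σ'
  disjoint : ∀ σ τ ρ, (σ, τ) ∈ pairs → (τ, ρ) ∉ pairs

namespace DiscreteVectorField

variable (V : K.DiscreteVectorField)

/-- One step `σ, τ, σ'` of a `V`-path: `(σ, τ)` is a vector of `V`, and `σ'` is a facet of `τ` other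
than `σ`. -/
def Step (σ σ' : K.Cell) : Prop := ∃ τ, (σ, τ) ∈ V.pairs ∧ K.IsFacet σ' τ ∧ σ' ≠ σ

/-- `V` is a discrete gradient vector field: there is no closed `V`-path. (The cells joined by
`Relation.TransGen V.Step` are those connected by a `V`-path with at least one step.) -/
def IsGradient : Prop := ∀ σ, ¬ Relation.TransGen V.Step σ σ

/-- A critical cell is one that belongs to no vector of `V`. -/
def IsCritical (σ : K.Cell) : Prop := ∀ ρ, (σ, ρ) ∉ V.pairs ∧ (ρ, σ) ∉ V.pairs

variable {n : ℕ} (𝒦 : K.MultiFiltration n)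

/-- `V` is consistent with the multi-filtration. -/
def IsConsistent : Prop :=
  ∀ σ τ, (σ, τ) ∈ V.pairs → ∀ u, σ ∈ (𝒦.sub u).cells ↔ τ ∈ (𝒦.sub u).cells

/-- The Morse number `m_q(u)`: the number of critical `q`-cells in `K^u - ⋃ᵢ K^{u - eᵢ}`. -/
noncomputable def morseNumber (q : ℤ) (u : Grade n) : ℕ :=
  {σ : K.Cell | V.IsCritical σ ∧ K.dim σ = q ∧
    σ ∈ (𝒦.sub u).cells ∧ σ ∉ (𝒦.previous u).cells}.ncard

/-- `V` is relative-perfect. -/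
def IsRelativePerfect : Prop :=
  ∀ (q : ℤ) (u : Grade n), V.morseNumber 𝒦 q u = Module.finrank F (𝒦.relHomology q u)

end DiscreteVectorField

end CellComplex

/-! ## Betti tables of persistence modules -/

/-- An `n`-parameter persistence module over `F`. This is the same thing as a `ℤⁿ`-graded module over
`P_n = F[x₁, …, x_n]`, with `x_i` acting through the structure maps `V_{u - eᵢ} → V_u`; the morphisms
are the linear maps of degree zero. -/
abbrev PersistenceModule (F : Type u) [Field F] (n : ℕ) : Type (max u (w + 1)) :=
  Grade n ⥤ ModuleCat.{w} F

namespace PersistenceModule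

variable {F : Type u} [Field F] {n : ℕ}

instance enoughProjectives [Small.{w} F] : EnoughProjectives (PersistenceModule.{u, w} F n) where
  presentation V := by
    let P : Grade n → PersistenceModule.{u, w} F n := fun u =>
      (evaluationLeftAdjoint (ModuleCat.{w} F) u).obj (Projective.over (V.obj u))
    let p : ∀ u, P u ⟶ V := fun u =>
      ((evaluationAdjunctionRight (ModuleCat.{w} F) u).homEquiv _ _).symm (Projective.π (V.obj u))
    have hP : ∀ u, Projective (P u) := fun u =>
      (evaluationAdjunctionRight (ModuleCat.{w} F) u).map_projective _ inferInstance
    refine ⟨{ p := Limits.sigmaObj P, projective := ?_, f := Limits.Sigma.desc p, epi := ?_ }⟩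
    · refine ⟨fun f e _ => ?_⟩
      refine ⟨Limits.Sigma.desc fun u => Projective.factorThru (Limits.Sigma.ι P u ≫ f) e, ?_⟩
      refine Limits.Sigma.hom_ext _ _ fun u => ?_
      rw [Limits.Sigma.ι_desc_assoc, Projective.factorThru_comp]
    rw [NatTrans.epi_iff_epi_app]
    intro u
    have h : (evaluationAdjunctionRight (ModuleCat.{w} F) u).unit.app _ ≫ (p u).app u =
        Projective.π (V.obj u) := by
      have := ((evaluationAdjunctionRight (ModuleCat.{w} F) u).homEquiv
        (Projective.over (V.obj u)) V).apply_symm_apply (Projective.π (V.obj u))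
      rw [Adjunction.homEquiv_unit] at this
      exact this
    have h2 : ((evaluationAdjunctionRight (ModuleCat.{w} F) u).unit.app _ ≫
        (Limits.Sigma.ι P u).app u) ≫ (Limits.Sigma.desc p).app u = Projective.π (V.obj u) := by
      rw [← h, Category.assoc, ← NatTrans.comp_app, Limits.Sigma.ι_desc]
    have : Epi (((evaluationAdjunctionRight (ModuleCat.{w} F) u).unit.app _ ≫
        (Limits.Sigma.ι P u).app u) ≫ (Limits.Sigma.desc p).app u) := by
      rw [h2]
      infer_instance
    exact epi_of_epi ((evaluationAdjunctionRight (ModuleCat.{w} F) u).unit.app _ ≫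
      (Limits.Sigma.ι P u).app u) _

/-- The image `x_i V_{u - eᵢ}` of multiplication by `x_i` in `V_u`. -/
def imageStep (V : PersistenceModule.{u, w} F n) (u : Grade n) (i : Fin n) :
    Submodule F (V.obj u) :=
  LinearMap.range
    (V.map (homOfLE (Grade.sub_e_le u i))).hom

/-- The functor `V ↦ (V ⊗_{P_n} F)_u`, where `F = P_n / (x₁, …, x_n)` sits in degree zero: this is the
degree `u` part `V_u / ∑ᵢ x_i V_{u - eᵢ}` of `V / (x₁, …, x_n) V`. -/
noncomputable def tensorResidue (F : Type u) [Field F] {n : ℕ} (u : Grade n) :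
    PersistenceModule.{u, w} F n ⥤ ModuleCat.{w} F where
  obj V := ModuleCat.of F (V.obj u ⧸ ⨆ i, V.imageStep u i)
  map {V W} f := ModuleCat.ofHom <| Submodule.mapQ _ _ (f.app u).hom <| by
    refine iSup_le fun i => ?_
    rintro _ ⟨a, rfl⟩
    refine Submodule.mem_iSup_of_mem i ⟨(f.app _).hom a, ?_⟩
    have := f.naturality (homOfLE (Grade.sub_e_le u i))
    exact (congrArg (fun g => g.hom a) this).symm
  map_id V := by
    refine ModuleCat.hom_ext (Submodule.linearMap_qext _ ?_)
    rfl
  map_comp f g := by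
    refine ModuleCat.hom_ext (Submodule.linearMap_qext _ ?_)
    rfl

instance tensorResidue_additive (u : Grade n) :
    (tensorResidue.{u, w} F u).Additive where
  map_add {V W f g} := by
    refine ModuleCat.hom_ext (Submodule.linearMap_qext _ ?_)
    rfl

/-- The Betti table `ξ_i^V(u) = dim_F Tor_i^{P_n}(V, F)_u`, where `Tor_i^{P_n}(-, F)_u` is the `i`-th
left derived functor of `V ↦ (V ⊗_{P_n} F)_u` on `ℤⁿ`-graded `P_n`-modules. -/
noncomputable def betti [Small.{w} F] (V : PersistenceModule.{u, w} F n) (i : ℕ) (u : Grade n) :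
    ℕ :=
  Module.finrank F (((tensorResidue.{u, w} F u).leftDerived i).obj V)

end PersistenceModule

/-- The Betti table `ξ_i^q(u)` of the persistence module `u ↦ H_q(K^u)`. -/
noncomputable def CellComplex.MultiFiltration.betti {F : Type u} [Field F]
    {K : CellComplex.{u, v} F} {n : ℕ} (𝒦 : K.MultiFiltration n) (i : ℕ) (q : ℤ)
    (u : Grade n) : ℕ :=
  PersistenceModule.betti.{u, max u v} (𝒦.persistentHomology q) i u

/-! Fix `u`. One-criticality gives K^{u-e₁} ∩ K^{u-e₂} = K^{u-e₁-e₂}, so there is an exact sequence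
of complexes 0 → C(K^{u-e₁-e₂}) → C(K^{u-e₁}) ⊕ C(K^{u-e₂}) → C(K^u) → C(K^u, K^{u-e₁} ∪ K^{u-e₂}) →
0. Cut it at the image Q of the middle map into two short exact sequences. Let r_p be the rank of
H_p(Q) → H_p(K^u), and β_p the rank of H_p(K^{u-e₁}) ⊕ H_p(K^{u-e₂}) → H_p(K^u). If the ξ_i are the
dimensions of the homology of the Koszul complex of the persistence module, the two long exact
sequences give dim H_q(K^u, K^{u-e₁} ∪ K^{u-e₂}) = ξ_0^q + ξ_1^{q-1} + ξ_2^{q-2} - (r_q - β_q) -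
(r_{q-1} - β_{q-1}). Moreover 0 ≤ r_p - β_p ≤ ξ_2^{p-1}, because the cokernel of H_p(K^{u-e₁}) ⊕
H_p(K^{u-e₂}) → H_p(Q) has dimension ξ_2^{p-1}. This bounds the relative homology on both sides
(`finrank_relHomology_bounds`). Morse numbers enter through the weak Morse inequality
`IsGradient.finrank_relHomology_le_morseNumber`, which is an equality by definition for
relative-perfect fields.

Tor is defined here by projective resolutions, so its agreement with Koszul homology has to be
proved (`PersistenceModule.betti_add_rank`). The same count `IsKoszulSquare.exists_ranks` does it,
applied to a resolution evaluated at the four grades: projectives are retracts of free modules,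
whose Koszul complex is exact; the values of the resolution have homology only in degree zero; and
the last term of the sequence computes Tor.

Sharpness comes from one complex with two filtrations. A vertex class is killed separately by two
edges, which makes ξ_2^0(1,1) nonzero and creates a 1-cycle at (1,1). The face filling this cycle
enters at (2,1) for the first inequality and at (1,1) for the second. -/

open CategoryTheory LinearMap HomologicalComplex


/-! ## Ranks of linear maps -/

namespace LinearMap

variable {F : Type*} [Field F] {L M N M' N' : Type*} [AddCommGroup L] [Module F L]
  [AddCommGroup M] [Module F M] [AddCommGroup N] [Module F N]
  [AddCommGroup M'] [Module F M'] [AddCommGroup N'] [Module F N']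

/-- The rank of a linear map, as a natural number. -/
noncomputable def finrk (f : M →ₗ[F] N) : ℕ := Module.finrank F (range f)

lemma finrk_add_finrk_of_exact [Module.Finite F M] {f : L →ₗ[F] M} {g : M →ₗ[F] N}
    (h : Function.Exact f g) : finrk f + finrk g = Module.finrank F M := by
  rw [finrk, finrk, ← g.finrank_range_add_finrank_ker, h.linearMap_ker_eq, add_comm]

lemma finrk_of_injective {f : M →ₗ[F] N} (h : Function.Injective f) :
    finrk f = Module.finrank F M :=
  finrank_range_of_inj h

lemma finrk_of_surjective {f : M →ₗ[F] N} (h : Function.Surjective f) :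
    finrk f = Module.finrank F N := by
  rw [finrk, range_eq_top.2 h, finrank_top]

lemma finrk_le [Module.Finite F N] (f : M →ₗ[F] N) : finrk f ≤ Module.finrank F N :=
  Submodule.finrank_le _

lemma finrk_eq_of_comm (e : M ≃ₗ[F] M') (e' : N ≃ₗ[F] N') {f : M →ₗ[F] N} {f' : M' →ₗ[F] N'}
    (h : ∀ x, e' (f x) = f' (e x)) : finrk f = finrk f' := by
  have h1 : range f' = (range f).map (e' : N →ₗ[F] N') := by
    ext y
    simp only [mem_range, Submodule.mem_map]
    constructor
    · rintro ⟨x, rfl⟩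
      exact ⟨_, ⟨e.symm x, rfl⟩, by simp [h]⟩
    · rintro ⟨_, ⟨x, rfl⟩, rfl⟩
      exact ⟨e x, by simp [h]⟩
  rw [finrk, finrk, h1]
  exact (LinearEquiv.finrank_map_eq e' _).symm

lemma finrk_comp_le [Module.Finite F N] (f : L →ₗ[F] M) (g : M →ₗ[F] N) :
    finrk (g ∘ₗ f) ≤ finrk g :=
  Submodule.finrank_mono (range_comp_le_range f g)

/-- Sylvester's rank inequality: the kernel of `g` restricted to the image of `f` embeds into the
kernel of `g`. -/
lemma finrk_add_finrk_le [Module.Finite F M] (f : L →ₗ[F] M) (g : M →ₗ[F] N) :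
    finrk g + finrk f ≤ finrk (g ∘ₗ f) + Module.finrank F M := by
  have h1 := (g.domRestrict (range f)).finrank_range_add_finrank_ker
  have h2 : range (g.domRestrict (range f)) = range (g ∘ₗ f) := by
    rw [range_domRestrict, range_comp]
  have h3 : Module.finrank F (ker (g.domRestrict (range f))) ≤ Module.finrank F (ker g) := by
    refine finrank_le_finrank_of_injective
      (f := ((range f).subtype ∘ₗ (ker (g.domRestrict (range f))).subtype).codRestrict (ker g)
        fun x => x.2) ?_
    intro x y hxy
    exact Subtype.ext (Subtype.ext (congrArg (fun z : ker g => (z : M)) hxy))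
  have h4 := g.finrank_range_add_finrank_ker
  rw [h2] at h1
  unfold finrk
  omega

lemma finite_of_exact [Module.Finite F L] [Module.Finite F N] {f : L →ₗ[F] M} {g : M →ₗ[F] N}
    (h : Function.Exact f g) : Module.Finite F M := by
  have h1 : Module.Finite F (ker g) := by
    rw [h.linearMap_ker_eq]
    infer_instance
  have h2 : Module.Finite F (M ⧸ ker g) := Module.Finite.equiv g.quotKerEquivRange.symm
  exact Module.Finite.of_submodule_quotient (ker g)

lemma finrk_neg_right (f : L →ₗ[F] M) (g : L →ₗ[F] N) : finrk (f.prod (-g)) = finrk (f.prod g) :=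
  finrk_eq_of_comm (.refl F L) ((LinearEquiv.refl F M).prodCongr (LinearEquiv.neg F)) (by simp)

end LinearMap

/-! ## Homology of exact sequences of complexes of vector spaces -/

namespace HomologicalComplex

variable {F : Type u} [Field F] {ι : Type*} {c : ComplexShape ι}

/-- The rank of the map induced in homology by a morphism of complexes. -/
noncomputable def homologyRank {X Y : HomologicalComplex (ModuleCat.{w} F) c} (f : X ⟶ Y) (i : ι) :
    ℕ :=
  finrk (homologyMap f i).hom

lemma homology_function_exact₂ {S : ShortComplex (HomologicalComplex (ModuleCat.{w} F) c)}
    (hS : S.ShortExact) (i : ι) :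
    Function.Exact (homologyMap S.f i).hom (homologyMap S.g i).hom :=
  LinearMap.exact_iff.2 (hS.homology_exact₂ i).moduleCat_range_eq_ker.symm

/-- Where no differential leaves degree `i`, homology is the cokernel of the incoming differential,
and cokernels preserve epimorphisms. This treats the degree at which the long exact sequence stops.
-/
lemma surjective_homologyMap_of_epi {X Y : HomologicalComplex (ModuleCat.{w} F) c} (g : X ⟶ Y)
    [Epi g] (i : ι) (hi : ¬ c.Rel i (c.next i)) :
    Function.Surjective (homologyMap g i).hom := by
  have h (K : HomologicalComplex (ModuleCat.{w} F) c) : IsIso (K.homologyι i) :=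
    ShortComplex.isIso_homologyι (K.sc i) (K.shape _ _ hi)
  have h2 : homologyMap g i = X.homologyι i ≫ opcyclesMap g i ≫ inv (Y.homologyι i) := by
    rw [← Category.assoc, IsIso.eq_comp_inv, homologyι_naturality]
  rw [← ModuleCat.epi_iff_surjective, h2]
  infer_instance

variable {S : ShortComplex (HomologicalComplex (ModuleCat.{w} F) c)} (hS : S.ShortExact)

include hS

/-- Finiteness is tracked on homology only, since the terms of a projective resolution may be
infinite-dimensional. -/
lemma finite_homology_X₃ (h1 : ∀ i, Module.Finite F (S.X₁.homology i))
    (h2 : ∀ i, Module.Finite F (S.X₂.homology i)) (i : ι) :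
    Module.Finite F (S.X₃.homology i) := by
  have := h1
  have := h2
  by_cases hi : c.Rel i (c.next i)
  · exact finite_of_exact (LinearMap.exact_iff.2
      (hS.homology_exact₃ i _ hi).moduleCat_range_eq_ker.symm)
  · have := hS.epi_g
    exact Module.Finite.of_surjective _ (surjective_homologyMap_of_epi S.g i hi)

/-- Rank-nullity at three consecutive places of the long exact sequence; the ranks of `S.g` and of
the connecting map cancel. -/
lemma finrank_homology_X₃_of_rel (h1 : ∀ i, Module.Finite F (S.X₁.homology i))
    (h2 : ∀ i, Module.Finite F (S.X₂.homology i)) {i j : ι} (hij : c.Rel i j) :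
    Module.finrank F (S.X₃.homology i) + homologyRank S.f i + homologyRank S.f j =
      Module.finrank F (S.X₂.homology i) + Module.finrank F (S.X₁.homology j) := by
  have := h1
  have := h2
  have := finite_homology_X₃ hS h1 h2
  have e1 := finrk_add_finrk_of_exact (LinearMap.exact_iff.2
      (hS.homology_exact₃ i j hij).moduleCat_range_eq_ker.symm)
  have e2 := finrk_add_finrk_of_exact (LinearMap.exact_iff.2
      (hS.homology_exact₁ i j hij).moduleCat_range_eq_ker.symm)
  have e3 := finrk_add_finrk_of_exact (homology_function_exact₂ hS i)
  dsimp only at e1 e2 e3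
  unfold homologyRank
  omega

lemma finrank_homology_X₃_of_not_rel (h2 : ∀ i, Module.Finite F (S.X₂.homology i)) {i : ι}
    (hi : ¬ c.Rel i (c.next i)) :
    Module.finrank F (S.X₃.homology i) + homologyRank S.f i =
      Module.finrank F (S.X₂.homology i) := by
  have := h2
  have := hS.epi_g
  have e3 := finrk_add_finrk_of_exact (homology_function_exact₂ hS i)
  have e4 := finrk_of_surjective (surjective_homologyMap_of_epi S.g i hi)
  unfold homologyRank
  omega

lemma homologyRank_g (h2 : ∀ i, Module.Finite F (S.X₂.homology i)) (i : ι) :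
    homologyRank S.f i + homologyRank S.g i = Module.finrank F (S.X₂.homology i) := by
  have := h2
  exact finrk_add_finrk_of_exact (homology_function_exact₂ hS i)

omit hS

/-- The numerical relations between the homology groups in an exact sequence
`0 → A → B → D → R → 0` of complexes of vector spaces. Here `s i` and `r i` are the dimension of
`Hᵢ(Q)` and the rank of `Hᵢ(Q) → Hᵢ(D)`, for `Q` the image of `B → D`. -/
lemma exists_ranks_of_exact {A B D R : HomologicalComplex (ModuleCat.{w} F) c}
    (f : A ⟶ B) (g : B ⟶ D) (p : D ⟶ R) [Mono f] [Epi p] (hfg : f ≫ g = 0) (hgp : g ≫ p = 0)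
    (h1 : (ShortComplex.mk f g hfg).Exact) (h2 : (ShortComplex.mk g p hgp).Exact)
    (hA : ∀ i, Module.Finite F (A.homology i)) (hB : ∀ i, Module.Finite F (B.homology i))
    (hD : ∀ i, Module.Finite F (D.homology i)) :
    ∃ r s : ι → ℕ,
      (∀ i j, c.Rel i j → s i + homologyRank f i + homologyRank f j =
        Module.finrank F (B.homology i) + Module.finrank F (A.homology j)) ∧
      (∀ i, ¬ c.Rel i (c.next i) → s i + homologyRank f i = Module.finrank F (B.homology i)) ∧
      (∀ i j, c.Rel i j → Module.finrank F (R.homology i) + r i + r j =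
        Module.finrank F (D.homology i) + s j) ∧
      (∀ i, ¬ c.Rel i (c.next i) → Module.finrank F (R.homology i) + r i =
        Module.finrank F (D.homology i)) ∧
      (∀ i, homologyRank g i ≤ r i) ∧ (∀ i, r i ≤ Module.finrank F (D.homology i)) ∧
      (∀ i, r i + Module.finrank F (B.homology i) ≤
        homologyRank g i + homologyRank f i + s i) := by
  -- Q is realised as the kernel of `p`, which by exactness is the image of `g`; this cuts the
  -- sequence into `S1` and `S2`.
  let g' : B ⟶ Limits.kernel p := Limits.kernel.lift p g hgp
  have hg' : g' ≫ Limits.kernel.ι p = g := Limits.kernel.lift_ι _ _ _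
  have hfg' : f ≫ g' = 0 := by
    rw [← cancel_mono (Limits.kernel.ι p), Category.assoc, hg', hfg, Limits.zero_comp]
  let S1 := ShortComplex.mk f g' hfg'
  let S2 := ShortComplex.mk (Limits.kernel.ι p) p (Limits.kernel.condition p)
  have e1 : S1.Exact := by
    let φ : S1 ⟶ ShortComplex.mk f g hfg :=
      { τ₁ := 𝟙 _, τ₂ := 𝟙 _, τ₃ := Limits.kernel.ι p, comm₂₃ := by simpa [S1] using hg'.symm }
    have : Epi φ.τ₁ := inferInstanceAs (Epi (𝟙 _))
    have : IsIso φ.τ₂ := inferInstanceAs (IsIso (𝟙 _))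
    have : Mono φ.τ₃ := inferInstanceAs (Mono (Limits.kernel.ι p))
    exact (ShortComplex.exact_iff_of_epi_of_isIso_of_mono φ).2 h1
  have : Epi g' := (ShortComplex.exact_iff_epi_kernel_lift _).1 h2
  have hS1 : S1.ShortExact := ⟨e1⟩
  have hS2 : S2.ShortExact := ⟨ShortComplex.exact_of_f_is_kernel _ (Limits.kernelIsKernel p)⟩
  have hQ : ∀ i, Module.Finite F ((Limits.kernel p).homology i) := finite_homology_X₃ hS1 hA hB
  have hcomp : ∀ i, (homologyMap (Limits.kernel.ι p) i).hom ∘ₗ (homologyMap g' i).hom =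
      (homologyMap g i).hom := fun i => by
    rw [← ModuleCat.hom_comp, ← homologyMap_comp, hg']
  refine ⟨homologyRank (Limits.kernel.ι p), fun i => Module.finrank F ((Limits.kernel p).homology i),
    fun i j hij => finrank_homology_X₃_of_rel hS1 hA hB hij,
    fun i hi => finrank_homology_X₃_of_not_rel hS1 hB hi,
    fun i j hij => finrank_homology_X₃_of_rel hS2 hQ hD hij,
    fun i hi => finrank_homology_X₃_of_not_rel hS2 hD hi,
    fun i => ?_, fun i => ?_, fun i => ?_⟩
  · have := hD
    rw [homologyRank, ← hcomp]
    exact finrk_comp_le _ _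
  · have := hD
    exact finrk_le _
  · have := hQ
    -- Only an inequality is available: H(B) → H(Q) need not be surjective, so `r` can exceed the
    -- rank of H(B) → H(D), by at most the dimension of the cokernel.
    have e3 := finrk_add_finrk_le (homologyMap g' i).hom (homologyMap (Limits.kernel.ι p) i).hom
    have e4 := homologyRank_g hS1 hB i
    rw [hcomp] at e3
    change homologyRank f i + homologyRank g' i = Module.finrank F (B.homology i) at e4
    unfold homologyRank at *
    dsimp only
    omega

end HomologicalComplex

/-! ### Direct sums of complexes and Koszul squares -/

namespace HomologicalComplex

variable {F : Type u} [Field F] {ι : Type*} {c : ComplexShape ι}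

/-- The isomorphism `Hᵢ(X ⊞ Y) ≃ Hᵢ(X) × Hᵢ(Y)`. -/
noncomputable def homologyBiprodEquiv (X Y : HomologicalComplex (ModuleCat.{w} F) c) (i : ι) :
    (X ⊞ Y).homology i ≃ₗ[F] X.homology i × Y.homology i :=
  LinearEquiv.ofLinearMap
    ((homologyMap (Limits.biprod.fst : X ⊞ Y ⟶ X) i).hom.prod
      (homologyMap (Limits.biprod.snd : X ⊞ Y ⟶ Y) i).hom)
    ((homologyMap (Limits.biprod.inl : X ⟶ X ⊞ Y) i).hom.coprod
      (homologyMap (Limits.biprod.inr : Y ⟶ X ⊞ Y) i).hom)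
    (by
      ext x : 2 <;>
      simp only [LinearMap.comp_assoc, LinearMap.coprod_inl, LinearMap.coprod_inr,
        LinearMap.id_comp, LinearMap.prod_comp, ← ModuleCat.hom_comp, ← homologyMap_comp,
        Limits.BinaryBicone.inl_fst, Limits.BinaryBicone.inl_snd, Limits.BinaryBicone.inr_fst,
        Limits.BinaryBicone.inr_snd, homologyMap_id, homologyMap_zero, ModuleCat.hom_id,
        ModuleCat.hom_zero] <;> rfl)
    (by
      rw [LinearMap.coprod_comp_prod, ← ModuleCat.hom_comp, ← ModuleCat.hom_comp,
        ← homologyMap_comp, ← homologyMap_comp, ← ModuleCat.hom_add, ← homologyMap_add,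
        Limits.biprod.total, homologyMap_id, ModuleCat.hom_id])

lemma homologyBiprodEquiv_apply (X Y : HomologicalComplex (ModuleCat.{w} F) c) (i : ι)
    (z : (X ⊞ Y).homology i) : homologyBiprodEquiv X Y i z =
      ((homologyMap (Limits.biprod.fst : X ⊞ Y ⟶ X) i).hom z,
        (homologyMap (Limits.biprod.snd : X ⊞ Y ⟶ Y) i).hom z) :=
  rfl

lemma homologyRank_lift {A X Y : HomologicalComplex (ModuleCat.{w} F) c} (a : A ⟶ X) (b : A ⟶ Y)
    (i : ι) : homologyRank (Limits.biprod.lift a b) i =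
      finrk ((homologyMap a i).hom.prod (homologyMap b i).hom) := by
  refine finrk_eq_of_comm (.refl F _) (homologyBiprodEquiv X Y i) fun z => ?_
  rw [homologyBiprodEquiv_apply, ← LinearMap.comp_apply, ← LinearMap.comp_apply,
    ← ModuleCat.hom_comp, ← ModuleCat.hom_comp,
    ← homologyMap_comp, ← homologyMap_comp, Limits.biprod.lift_fst, Limits.biprod.lift_snd]
  rfl

lemma homologyRank_desc {D X Y : HomologicalComplex (ModuleCat.{w} F) c} (a : X ⟶ D) (b : Y ⟶ D)
    (i : ι) : homologyRank (Limits.biprod.desc a b) i =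
      finrk ((homologyMap a i).hom.coprod (homologyMap b i).hom) := by
  refine finrk_eq_of_comm (homologyBiprodEquiv X Y i) (.refl F _) fun z => ?_
  have h1 : Limits.biprod.desc a b = Limits.biprod.fst ≫ a + Limits.biprod.snd ≫ b := by
    refine Limits.biprod.hom_ext' _ _ ?_ ?_ <;> simp
  rw [h1, homologyMap_add, homologyMap_comp, homologyMap_comp, homologyBiprodEquiv_apply]
  rfl

lemma finite_homology_biprod (X Y : HomologicalComplex (ModuleCat.{w} F) c) (i : ι)
    [Module.Finite F (X.homology i)] [Module.Finite F (Y.homology i)] :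
    Module.Finite F ((X ⊞ Y).homology i) :=
  Module.Finite.equiv (homologyBiprodEquiv X Y i).symm

lemma finrank_homology_biprod (X Y : HomologicalComplex (ModuleCat.{w} F) c) (i : ι)
    [Module.Finite F (X.homology i)] [Module.Finite F (Y.homology i)] :
    Module.finrank F ((X ⊞ Y).homology i) =
      Module.finrank F (X.homology i) + Module.finrank F (Y.homology i) :=
  (homologyBiprodEquiv X Y i).finrank_eq.trans Module.finrank_prod

/-- A commutative square `A, X, Y, D` of complexes such that, in each degree, `A` is the pullback of
`X` and `Y` over `D` and embeds into `X × Y`, together with the cokernel `R` of `X × Y → D`. -/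
structure IsKoszulSquare {A X Y D R : HomologicalComplex (ModuleCat.{w} F) c}
    (a : A ⟶ X) (a' : A ⟶ Y) (b : X ⟶ D) (b' : Y ⟶ D) (p : D ⟶ R) : Prop where
  comm : a ≫ b = a' ≫ b'
  zero : b ≫ p = 0
  zero' : b' ≫ p = 0
  injective : ∀ n (x : A.X n), (a.f n).hom x = 0 → (a'.f n).hom x = 0 → x = 0
  exists_lift : ∀ n (x : X.X n) (y : Y.X n), (b.f n).hom x = (b'.f n).hom y →
    ∃ z, (a.f n).hom z = x ∧ (a'.f n).hom z = y
  exact : ∀ n (z : D.X n), (p.f n).hom z = 0 → ∃ x y, z = (b.f n).hom x + (b'.f n).hom y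
  surjective : ∀ n, Function.Surjective (p.f n).hom

lemma mono_of_injective {A B : HomologicalComplex (ModuleCat.{w} F) c} (f : A ⟶ B)
    (h : ∀ n, Function.Injective (f.f n).hom) : Mono f := by
  have : ∀ n, Mono (f.f n) := fun n => (ModuleCat.mono_iff_injective _).2 (h n)
  exact mono_of_mono_f f this

lemma epi_of_surjective {A B : HomologicalComplex (ModuleCat.{w} F) c} (f : A ⟶ B)
    (h : ∀ n, Function.Surjective (f.f n).hom) : Epi f := by
  have : ∀ n, Epi (f.f n) := fun n => (ModuleCat.epi_iff_surjective _).2 (h n)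
  exact epi_of_epi_f f this

lemma exact_of_exists {A B D : HomologicalComplex (ModuleCat.{w} F) c} (f : A ⟶ B) (g : B ⟶ D)
    (hfg : f ≫ g = 0)
    (h : ∀ n (x : B.X n), (g.f n).hom x = 0 → ∃ y, (f.f n).hom y = x) :
    (ShortComplex.mk f g hfg).Exact :=
  exact_of_degreewise_exact _ fun n => (ShortComplex.moduleCat_exact_iff _).2 (h n)

/-- The four-term count applied to A → X ⊞ Y → D → R. The component `a'` gets a minus sign so that
the composite is zero, which does not affect ranks. The ranks `α` and `β` are free functions so that
they can be matched with ranks of structure maps of a persistence module. -/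
theorem IsKoszulSquare.exists_ranks {A X Y D R : HomologicalComplex (ModuleCat.{w} F) c}
    {a : A ⟶ X} {a' : A ⟶ Y} {b : X ⟶ D} {b' : Y ⟶ D} {p : D ⟶ R}
    (h : IsKoszulSquare a a' b b' p)
    (hA : ∀ i, Module.Finite F (A.homology i)) (hX : ∀ i, Module.Finite F (X.homology i))
    (hY : ∀ i, Module.Finite F (Y.homology i)) (hD : ∀ i, Module.Finite F (D.homology i))
    {α β : ι → ℕ} (hα : ∀ i, α i = finrk ((homologyMap a i).hom.prod (homologyMap a' i).hom))
    (hβ : ∀ i, β i = finrk ((homologyMap b i).hom.coprod (homologyMap b' i).hom)) :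
    ∃ r s : ι → ℕ,
      (∀ i j, c.Rel i j → s i + α i + α j =
        Module.finrank F (X.homology i) + Module.finrank F (Y.homology i) +
          Module.finrank F (A.homology j)) ∧
      (∀ i, ¬ c.Rel i (c.next i) → s i + α i =
        Module.finrank F (X.homology i) + Module.finrank F (Y.homology i)) ∧
      (∀ i j, c.Rel i j → Module.finrank F (R.homology i) + r i + r j =
        Module.finrank F (D.homology i) + s j) ∧
      (∀ i, ¬ c.Rel i (c.next i) → Module.finrank F (R.homology i) + r i =
        Module.finrank F (D.homology i)) ∧
      (∀ i, β i ≤ r i) ∧ (∀ i, r i ≤ Module.finrank F (D.homology i)) ∧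
      (∀ i, r i + Module.finrank F (X.homology i) + Module.finrank F (Y.homology i) ≤
        β i + α i + s i) := by
  have hlift (i : ι) : homologyRank (Limits.biprod.lift a (-a')) i = α i := by
    rw [homologyRank_lift, homologyMap_neg, ModuleCat.hom_neg, finrk_neg_right, hα]
  have hdesc (i : ι) : homologyRank (Limits.biprod.desc b b') i = β i := by
    rw [homologyRank_desc, hβ]
  have hfst (n : ι) (x : A.X n) : ((Limits.biprod.fst : X ⊞ Y ⟶ X).f n).hom
      (((Limits.biprod.lift a (-a')).f n).hom x) = (a.f n).hom x := by
    rw [← LinearMap.comp_apply, ← ModuleCat.hom_comp, biprod_lift_fst_f]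
  have hsnd (n : ι) (x : A.X n) : ((Limits.biprod.snd : X ⊞ Y ⟶ Y).f n).hom
      (((Limits.biprod.lift a (-a')).f n).hom x) = - (a'.f n).hom x := by
    rw [← LinearMap.comp_apply, ← ModuleCat.hom_comp, biprod_lift_snd_f]
    rfl
  have hdes (n : ι) (z : (X ⊞ Y).X n) : ((Limits.biprod.desc b b').f n).hom z =
      (b.f n).hom (((Limits.biprod.fst : X ⊞ Y ⟶ X).f n).hom z) +
        (b'.f n).hom (((Limits.biprod.snd : X ⊞ Y ⟶ Y).f n).hom z) := by
    have h1 : Limits.biprod.desc b b' = Limits.biprod.fst ≫ b + Limits.biprod.snd ≫ b' := by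
      refine Limits.biprod.hom_ext' _ _ ?_ ?_ <;> simp
    rw [h1]
    rfl
  have hext (n : ι) (z z' : (X ⊞ Y).X n)
      (h1 : ((Limits.biprod.fst : X ⊞ Y ⟶ X).f n).hom z =
        ((Limits.biprod.fst : X ⊞ Y ⟶ X).f n).hom z')
      (h2 : ((Limits.biprod.snd : X ⊞ Y ⟶ Y).f n).hom z =
        ((Limits.biprod.snd : X ⊞ Y ⟶ Y).f n).hom z') : z = z' := by
    have ht := congrArg (fun f => ModuleCat.Hom.hom f) (biprod_total_f X Y n)
    have ht1 := LinearMap.congr_fun ht z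
    have ht2 := LinearMap.congr_fun ht z'
    simp only [ModuleCat.hom_add, ModuleCat.hom_comp, LinearMap.add_apply, LinearMap.comp_apply,
      ModuleCat.hom_id, LinearMap.id_apply] at ht1 ht2
    rw [← ht1, ← ht2, h1, h2]
  have hsurj (n : ι) (x : X.X n) (y : Y.X n) : ∃ z : (X ⊞ Y).X n,
      ((Limits.biprod.fst : X ⊞ Y ⟶ X).f n).hom z = x ∧
        ((Limits.biprod.snd : X ⊞ Y ⟶ Y).f n).hom z = y := by
    have c1 := LinearMap.congr_fun (congrArg (fun f => ModuleCat.Hom.hom f)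
      (biprod_inl_fst_f X Y n)) x
    have c2 := LinearMap.congr_fun (congrArg (fun f => ModuleCat.Hom.hom f)
      (biprod_inl_snd_f X Y n)) x
    have c3 := LinearMap.congr_fun (congrArg (fun f => ModuleCat.Hom.hom f)
      (biprod_inr_fst_f X Y n)) y
    have c4 := LinearMap.congr_fun (congrArg (fun f => ModuleCat.Hom.hom f)
      (biprod_inr_snd_f X Y n)) y
    simp only [ModuleCat.hom_comp, LinearMap.comp_apply, ModuleCat.hom_id, LinearMap.id_apply,
      ModuleCat.hom_zero, LinearMap.zero_apply] at c1 c2 c3 c4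
    refine ⟨((Limits.biprod.inl : X ⟶ X ⊞ Y).f n).hom x +
      ((Limits.biprod.inr : Y ⟶ X ⊞ Y).f n).hom y, ?_, ?_⟩
    · rw [map_add, c1, c3, add_zero]
    · rw [map_add, c2, c4, zero_add]
  have : Mono (Limits.biprod.lift a (-a')) := by
    refine mono_of_injective _ fun n => ?_
    rw [injective_iff_map_eq_zero]
    intro x hx
    refine h.injective n x ?_ ?_
    · rw [← hfst, hx, map_zero]
    · rw [← neg_eq_zero, ← hsnd, hx, map_zero]
  have : Epi p := epi_of_surjective _ h.surjective
  have hB (i : ι) : Module.Finite F ((X ⊞ Y).homology i) := by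
    have := hX
    have := hY
    exact finite_homology_biprod X Y i
  have hBr (i : ι) : Module.finrank F ((X ⊞ Y).homology i) =
      Module.finrank F (X.homology i) + Module.finrank F (Y.homology i) := by
    have := hX
    have := hY
    exact finrank_homology_biprod X Y i
  have key := exists_ranks_of_exact (Limits.biprod.lift a (-a')) (Limits.biprod.desc b b') p
    (by rw [Limits.biprod.lift_desc, Preadditive.neg_comp, h.comm, add_neg_cancel])
    (by refine Limits.biprod.hom_ext' _ _ ?_ ?_ <;> simp [h.zero, h.zero'])
    (exact_of_exists _ _ _ fun n z hz => by
      rw [hdes] at hz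
      obtain ⟨x, hx, hx'⟩ := h.exists_lift n (((Limits.biprod.fst : X ⊞ Y ⟶ X).f n).hom z)
        (-((Limits.biprod.snd : X ⊞ Y ⟶ Y).f n).hom z) (by rw [map_neg, ← add_eq_zero_iff_eq_neg, hz])
      refine ⟨x, hext n _ _ ?_ ?_⟩
      · rw [hfst, hx]
      · rw [hsnd, hx', neg_neg])
    (exact_of_exists _ _ _ fun n z hz => by
      obtain ⟨x, y, rfl⟩ := h.exact n z hz
      obtain ⟨w, hw, hw'⟩ := hsurj n x y
      exact ⟨w, by rw [hdes, hw, hw']⟩)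
    hA hB hD
  simpa only [hlift, hdesc, hBr, ← add_assoc] using key

end HomologicalComplex

/-! ### The order on grades -/

namespace Grade

lemma le_iff {n : ℕ} {u v : Grade n} : u ≤ v ↔ ∀ i, (u i : ℤ) ≤ v i :=
  Iff.rfl

lemma sub_e_apply_self {n : ℕ} (u : Grade n) (i : Fin n) : (u - e i) i = u i - 1 := by
  change u i - (Pi.single i 1 : Fin n → ℤ) i = _
  rw [Pi.single_eq_same]

lemma sub_e_apply_of_ne {n : ℕ} (u : Grade n) {i j : Fin n} (h : j ≠ i) : (u - e i) j = u j := by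
  change u j - (Pi.single i 1 : Fin n → ℤ) j = _
  rw [Pi.single_eq_of_ne h, sub_zero]

lemma le_sub_e_iff {n : ℕ} {w u : Grade n} {i : Fin n} :
    w ≤ u - e i ↔ w ≤ u ∧ (w i : ℤ) < u i := by
  constructor
  · intro hw
    refine ⟨hw.trans (sub_e_le u i), ?_⟩
    have := le_iff.1 hw i
    rw [sub_e_apply_self] at this
    omega
  · rintro ⟨h1, h2⟩
    refine le_iff.2 fun j => ?_
    by_cases hj : j = i
    · subst hj
      rw [sub_e_apply_self]
      omega
    · rw [sub_e_apply_of_ne u hj]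
      exact h1 j

lemma sub_e_sub_e_le {n : ℕ} (u : Grade n) (i j : Fin n) : u - e i - e j ≤ u - e j := by
  rw [sub_right_comm]
  exact sub_e_le _ i

/-- The grade `u - e i - e j` is the meet of `u - e i` and `u - e j`. This is the source of every
pullback property below. -/
lemma le_sub_e_sub_e {n : ℕ} {w u : Grade n} {i j : Fin n} (hij : i ≠ j) (hi : w ≤ u - e i)
    (hj : w ≤ u - e j) : w ≤ u - e i - e j := by
  refine le_sub_e_iff.2 ⟨hi, ?_⟩
  rw [sub_e_apply_of_ne u hij.symm]
  exact (le_sub_e_iff.1 hj).2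

end Grade

namespace PersistenceModule

variable {F : Type u} [Field F]

/-! ### Projective persistence modules are Koszul acyclic -/

section Cover

variable {n : ℕ} (V : PersistenceModule.{u, w} F n)

/-- The elements of `⨁_w V_w` that vanish outside of the grades `w ≤ u`. -/
def coverSubmodule (u : Grade n) : Submodule F (DirectSum (Grade n) fun w => V.obj w) where
  carrier := {f | ∀ w, ¬ w ≤ u → f w = 0}
  add_mem' := fun {f g} hf hg w hw => by rw [DirectSum.add_apply, hf w hw, hg w hw, add_zero]
  zero_mem' := fun _ _ => rfl
  smul_mem' := fun a f hf w hw => by rw [DirectSum.smul_apply, hf w hw, smul_zero]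

lemma coverSubmodule_mono {u u' : Grade n} (h : u ≤ u') :
    V.coverSubmodule u ≤ V.coverSubmodule u' :=
  fun _ hf w hw => hf w fun hwu => hw (hwu.trans h)

/-- The free persistence module on the graded vector space underlying `V`. -/
def cover : PersistenceModule.{u, w} F n where
  obj u := ModuleCat.of F (V.coverSubmodule u)
  map h := ModuleCat.ofHom (Submodule.inclusion (V.coverSubmodule_mono (leOfHom h)))

open scoped Classical in
/-- The linear map from `⨁_w V_w` to `V_u` that is the structure map on `V_w` for `w ≤ u` and zero
on the other summands. -/
noncomputable def coverMap (u : Grade n) : (DirectSum (Grade n) fun w => V.obj w) →ₗ[F] V.obj u :=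
  DirectSum.toModule F (Grade n) (V.obj u) fun w =>
    if h : w ≤ u then (V.map (homOfLE h)).hom else 0

open scoped Classical in
lemma coverMap_lof {u w : Grade n} (h : w ≤ u) (x : V.obj w) :
    V.coverMap u (DirectSum.lof F (Grade n) (fun w => V.obj w) w x) =
      (V.map (homOfLE h)).hom x := by
  rw [coverMap, DirectSum.toModule_lof, dif_pos h]

/-- The support condition is essential: `coverMap u` discards the summands at grades not below `u`,
some of which `coverMap u'` may keep. On the remaining summands the claim is functoriality of `V`.
-/
lemma map_coverMap {u u' : Grade n} (h : u ≤ u') (f : DirectSum (Grade n) fun w => V.obj w)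
    (hf : f ∈ V.coverSubmodule u) :
    (V.map (homOfLE h)).hom (V.coverMap u f) = V.coverMap u' f := by
  classical
  have hsum := DirectSum.sum_support_of f
  rw [← hsum]
  simp only [map_sum]
  refine Finset.sum_congr rfl fun w hw => ?_
  have hwu : w ≤ u := by
    by_contra hwu
    exact (DFinsupp.mem_support_iff.1 hw) (hf w hwu)
  have h1 := V.coverMap_lof hwu (f w)
  have h2 := V.coverMap_lof (hwu.trans h) (f w)
  rw [DirectSum.lof_eq_of] at h1 h2
  rw [h1, h2, ← LinearMap.comp_apply, ← ModuleCat.hom_comp, ← V.map_comp]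
  rfl

/-- The canonical morphism from the cover of `V` to `V`. -/
noncomputable def coverπ : V.cover ⟶ V where
  app u := ModuleCat.ofHom (V.coverMap u ∘ₗ (V.coverSubmodule u).subtype)
  naturality u u' h := by
    ext f
    exact (V.map_coverMap (leOfHom h) f.1 f.2).symm

instance : Epi V.coverπ := by
  classical
  rw [NatTrans.epi_iff_epi_app]
  intro u
  rw [ModuleCat.epi_iff_surjective]
  intro x
  refine ⟨⟨DirectSum.lof F (Grade n) (fun w => V.obj w) u x, ?_⟩, ?_⟩
  · intro w hw
    rw [DirectSum.lof_eq_of]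
    exact DirectSum.of_eq_of_ne _ _ _ fun h => hw h.le
  · refine (V.coverMap_lof le_rfl x).trans ?_
    have : homOfLE (le_refl u) = 𝟙 u := rfl
    rw [this, V.map_id]
    rfl

end Cover

variable (V : PersistenceModule.{u, w} F 2)

/-- The Koszul complex `V_{u-e₁-e₂} → V_{u-e₁} × V_{u-e₂} → V_u` is exact except at `V_u`. -/
structure IsKoszulAcyclic (u : Grade 2) : Prop where
  injective : ∀ x : V.obj (u - .e 0 - .e 1),
    (V.map (homOfLE (Grade.sub_e_le (u - .e 0) 1))).hom x = 0 → x = 0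
  exists_lift : ∀ (x : V.obj (u - .e 0)) (y : V.obj (u - .e 1)),
    (V.map (homOfLE (Grade.sub_e_le u 0))).hom x = (V.map (homOfLE (Grade.sub_e_le u 1))).hom y →
    ∃ z, (V.map (homOfLE (Grade.sub_e_le (u - .e 0) 1))).hom z = x ∧
      (V.map (homOfLE (Grade.sub_e_sub_e_le u 0 1))).hom z = y

/-- All values of the cover are subspaces of the same direct sum and its structure maps are
inclusions. The pullback is therefore an intersection, namely the elements supported below the meet
of the two grades. -/
lemma isKoszulAcyclic_cover (u : Grade 2) : IsKoszulAcyclic V.cover u where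
  injective x hx := Subtype.ext (congrArg (fun z : V.coverSubmodule (u - .e 0) => z.1) hx)
  exists_lift x y hxy := by
    have h : x.1 = y.1 := congrArg (fun z : V.coverSubmodule u => z.1) hxy
    refine ⟨⟨x.1, fun w hw => ?_⟩, rfl, Subtype.ext h⟩
    by_contra hne
    have h0 : w ≤ u - .e 0 := by
      by_contra h0
      exact hne (x.2 w h0)
    have h1 : w ≤ u - .e 1 := by
      by_contra h1
      exact hne (h ▸ y.2 w h1)
    exact hw (Grade.le_sub_e_sub_e (by decide) h0 h1)

variable {V}

lemma app_map {n : ℕ} {V W : PersistenceModule.{u, w} F n} (f : V ⟶ W) {u u' : Grade n}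
    (h : u ⟶ u') (x : V.obj u) :
    (f.app u').hom ((V.map h).hom x) = (W.map h).hom ((f.app u).hom x) :=
  congrArg (fun g => ModuleCat.Hom.hom g x) (f.naturality h)

/-- Push the data into `W` by `s`, solve there, and come back by `r`. -/
lemma IsKoszulAcyclic.of_retract {W : PersistenceModule.{u, w} F 2} {u : Grade 2}
    (hW : IsKoszulAcyclic W u) (s : V ⟶ W) (r : W ⟶ V) (h : s ≫ r = 𝟙 V) :
    IsKoszulAcyclic V u := by
  have hs (w : Grade 2) (x : V.obj w) : (r.app w).hom ((s.app w).hom x) = x :=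
    congrArg (fun g => ModuleCat.Hom.hom (NatTrans.app g w) x) h
  refine ⟨fun x hx => ?_, fun x y hxy => ?_⟩
  · rw [← hs _ x, hW.injective ((s.app _).hom x) (by rw [← app_map, hx, map_zero]), map_zero]
  · obtain ⟨z, hz, hz'⟩ := hW.exists_lift ((s.app _).hom x) ((s.app _).hom y)
      (by rw [← app_map, ← app_map, hxy])
    exact ⟨(r.app _).hom z, by rw [← app_map, hz, hs], by rw [← app_map, hz', hs]⟩

/-- A projective module is a retract of its cover, since the epimorphism `coverπ` splits. -/
lemma isKoszulAcyclic_of_projective [Projective V] (u : Grade 2) : IsKoszulAcyclic V u :=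
  (isKoszulAcyclic_cover V u).of_retract (Projective.factorThru (𝟙 V) V.coverπ) V.coverπ
    (Projective.factorThru_comp _ _)

end PersistenceModule

/-! ### The homology of complexes with zero differential -/

namespace HomologicalComplex

variable {F : Type u} [Field F] {ι : Type*} {c : ComplexShape ι}

lemma isIso_iCycles_of_d_eq_zero {K : HomologicalComplex (ModuleCat.{w} F) c}
    (hK : ∀ i j, K.d i j = 0) (i : ι) : IsIso (K.iCycles i) :=
  K.isIso_iCycles i _ rfl (hK _ _)

lemma isIso_homologyπ_of_d_eq_zero {K : HomologicalComplex (ModuleCat.{w} F) c}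
    (hK : ∀ i j, K.d i j = 0) (i : ι) : IsIso (K.homologyπ i) :=
  K.isIso_homologyπ _ i rfl (hK _ _)

/-- The homology of a complex with zero differential. -/
noncomputable def homologyEquivOfDEqZero {K : HomologicalComplex (ModuleCat.{w} F) c}
    (hK : ∀ i j, K.d i j = 0) (i : ι) : K.homology i ≃ₗ[F] K.X i :=
  letI := isIso_iCycles_of_d_eq_zero hK i
  letI := isIso_homologyπ_of_d_eq_zero hK i
  ((asIso (K.homologyπ i)).symm ≪≫ asIso (K.iCycles i)).toLinearEquiv

lemma homologyEquivOfDEqZero_naturality {K L : HomologicalComplex (ModuleCat.{w} F) c}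
    (hK : ∀ i j, K.d i j = 0) (hL : ∀ i j, L.d i j = 0) (φ : K ⟶ L) (i : ι) (x : K.homology i) :
    homologyEquivOfDEqZero hL i ((homologyMap φ i).hom x) =
      (φ.f i).hom (homologyEquivOfDEqZero hK i x) := by
  have := isIso_iCycles_of_d_eq_zero hK i
  have := isIso_homologyπ_of_d_eq_zero hK i
  have := isIso_iCycles_of_d_eq_zero hL i
  have := isIso_homologyπ_of_d_eq_zero hL i
  have h : homologyMap φ i ≫ inv (L.homologyπ i) ≫ L.iCycles i =
      (inv (K.homologyπ i) ≫ K.iCycles i) ≫ φ.f i := by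
    rw [← cancel_epi (K.homologyπ i), homologyπ_naturality_assoc, IsIso.hom_inv_id_assoc,
      Category.assoc, IsIso.hom_inv_id_assoc, cyclesMap_i]
  exact congrArg (fun g => ModuleCat.Hom.hom g x) h

end HomologicalComplex

/-! ### Betti tables as Koszul homology -/

namespace PersistenceModule

variable {F : Type u} [Field F]

/-- The chain complex of the values at the grade `w` of a complex of persistence modules. -/
noncomputable abbrev evalComplex {n : ℕ} (P : ChainComplex (PersistenceModule.{u, w} F n) ℕ)
    (w : Grade n) : ChainComplex (ModuleCat.{w} F) ℕ :=
  (((evaluation (Grade n) (ModuleCat.{w} F)).obj w).mapHomologicalComplex _).obj P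

/-- The structure maps between the values of a complex of persistence modules. -/
noncomputable abbrev evalComplexMap {n : ℕ} (P : ChainComplex (PersistenceModule.{u, w} F n) ℕ)
    {w w' : Grade n} (h : w ≤ w') : evalComplex P w ⟶ evalComplex P w' :=
  (NatTrans.mapHomologicalComplex ((evaluation (Grade n) (ModuleCat.{w} F)).map (homOfLE h)) _).app P

/-- The projection `V_u → (V ⊗ F)_u`. -/
noncomputable def toTensorResidue {n : ℕ} (u : Grade n) :
    (evaluation (Grade n) (ModuleCat.{w} F)).obj u ⟶ tensorResidue.{u, w} F u where
  app _ := ModuleCat.ofHom (Submodule.mkQ _)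
  naturality _ _ _ := rfl

lemma evalComplexMap_comp {n : ℕ} (P : ChainComplex (PersistenceModule.{u, w} F n) ℕ)
    {w w' w'' : Grade n} (h : w ≤ w') (h' : w' ≤ w'') :
    evalComplexMap P h ≫ evalComplexMap P h' = evalComplexMap P (h.trans h') := by
  ext i : 1
  exact ((P.X i).map_comp (homOfLE h) (homOfLE h')).symm

/-- Each term of `P` is projective, hence Koszul acyclic, and `tensorResidue` is by construction the
quotient by the two images. -/
lemma isKoszulSquare_evalComplex (P : ChainComplex (PersistenceModule.{u, w} F 2) ℕ)
    [∀ i, Projective (P.X i)] (u : Grade 2) :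
    IsKoszulSquare (evalComplexMap P (Grade.sub_e_le (u - .e 0) 1))
      (evalComplexMap P (Grade.sub_e_sub_e_le u 0 1))
      (evalComplexMap P (Grade.sub_e_le u 0)) (evalComplexMap P (Grade.sub_e_le u 1))
      ((NatTrans.mapHomologicalComplex (toTensorResidue u) _).app P) where
  comm := by
    rw [evalComplexMap_comp, evalComplexMap_comp]
  zero := by
    ext i x
    exact (Submodule.Quotient.mk_eq_zero _).2 (Submodule.mem_iSup_of_mem 0 ⟨x, rfl⟩)
  zero' := by
    ext i x
    exact (Submodule.Quotient.mk_eq_zero _).2 (Submodule.mem_iSup_of_mem 1 ⟨x, rfl⟩)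
  injective n x hx _ := (isKoszulAcyclic_of_projective (V := P.X n) u).injective x hx
  exists_lift n x y hxy := (isKoszulAcyclic_of_projective (V := P.X n) u).exists_lift x y hxy
  exact n z hz := by
    change (P.X n).obj u at z
    have h : z ∈ ⨆ i, (P.X n).imageStep u i := (Submodule.Quotient.mk_eq_zero _).1 hz
    have h2 : ⨆ i, (P.X n).imageStep u i = (P.X n).imageStep u 0 ⊔ (P.X n).imageStep u 1 := by
      refine le_antisymm (iSup_le fun i => ?_) (sup_le (le_iSup _ 0) (le_iSup _ 1))
      fin_cases i
      · exact le_sup_left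
      · exact le_sup_right
    obtain ⟨_, ⟨x, rfl⟩, _, ⟨y, rfl⟩, rfl⟩ := Submodule.mem_sup.1 (h2 ▸ h)
    exact ⟨x, y, rfl⟩
  surjective n := Submodule.mkQ_surjective _

section Resolution

variable {n : ℕ} {V : PersistenceModule.{u, w} F n} (P : ProjectiveResolution V)

lemma single_eval_d {w : Grade n} (i j : ℕ) :
    (evalComplex ((ChainComplex.single₀ _).obj V) w).d i j = 0 :=
  rfl

/-- The homology of the values at `w` of a resolution of `V` is `V_w`, in degree zero. -/
noncomputable def homologyEvalEquiv (w : Grade n) (i : ℕ) :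
    (evalComplex P.complex w).homology i ≃ₗ[F]
      (evalComplex ((ChainComplex.single₀ _).obj V) w).X i :=
  (asIso (homologyMap ((((evaluation (Grade n) (ModuleCat.{w} F)).obj w).mapHomologicalComplex
    _).map P.π) i)).toLinearEquiv ≪≫ₗ homologyEquivOfDEqZero single_eval_d i

/-- Dimensions alone would not suffice: compatibility with the structure maps is what transports the
ranks `rankIn` and `rankOut` to the homology of the resolution. -/
lemma homologyEvalEquiv_naturality {w w' : Grade n} (h : w ≤ w') (i : ℕ)
    (x : (evalComplex P.complex w).homology i) :
    homologyEvalEquiv P w' i ((homologyMap (evalComplexMap P.complex h) i).hom x) =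
      ((evalComplexMap ((ChainComplex.single₀ _).obj V) h).f i).hom
        (homologyEvalEquiv P w i x) := by
  refine Eq.trans ?_ (homologyEquivOfDEqZero_naturality single_eval_d single_eval_d
    (evalComplexMap ((ChainComplex.single₀ _).obj V) h) i _)
  refine congrArg (homologyEquivOfDEqZero _ i) ?_
  let π (w : Grade n) := (((evaluation (Grade n) (ModuleCat.{w} F)).obj w).mapHomologicalComplex
    (ComplexShape.down ℕ)).map P.π
  have key : homologyMap (evalComplexMap P.complex h) i ≫ homologyMap (π w') i =
      homologyMap (π w) i ≫ homologyMap (evalComplexMap ((ChainComplex.single₀ _).obj V) h) i := by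
    rw [← homologyMap_comp, ← homologyMap_comp]
    exact congrArg (fun f => homologyMap f i) ((NatTrans.mapHomologicalComplex
      ((evaluation (Grade n) (ModuleCat.{w} F)).map (homOfLE h)) _).naturality P.π).symm
  exact congrArg (fun g => ModuleCat.Hom.hom g x) key

lemma subsingleton_homology_eval (w : Grade n) (i : ℕ) :
    Subsingleton ((evalComplex P.complex w).homology (i + 1)) := by
  have h : Limits.IsZero (((ChainComplex.single₀ _).obj V).X (i + 1)) :=
    isZero_single_obj_X _ _ _ _ (by simp)
  have h2 : Subsingleton ((evalComplex ((ChainComplex.single₀ _).obj V) w).X (i + 1)) :=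
    ModuleCat.subsingleton_of_isZero (((evaluation _ _).obj w).map_isZero h)
  exact (homologyEvalEquiv P w (i + 1)).injective.subsingleton

lemma finite_homology_eval (w : Grade n) [Module.Finite F (V.obj w)] (i : ℕ) :
    Module.Finite F ((evalComplex P.complex w).homology i) := by
  cases i with
  | zero =>
    have : Module.Finite F ((evalComplex ((ChainComplex.single₀ _).obj V) w).X 0) :=
      inferInstanceAs (Module.Finite F (V.obj w))
    exact Module.Finite.equiv (homologyEvalEquiv P w 0).symm
  | succ i =>
    have := subsingleton_homology_eval P w i
    infer_instance

lemma finrank_homology_eval_zero (w : Grade n) :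
    Module.finrank F ((evalComplex P.complex w).homology 0) = Module.finrank F (V.obj w) :=
  (homologyEvalEquiv P w 0).finrank_eq

lemma finrank_homology_eval_succ (w : Grade n) (i : ℕ) :
    Module.finrank F ((evalComplex P.complex w).homology (i + 1)) = 0 := by
  have := subsingleton_homology_eval P w i
  exact Module.finrank_zero_of_subsingleton

end Resolution

/-- The rank of `V_{u-e₁-e₂} → V_{u-e₁} × V_{u-e₂}`. -/
noncomputable def rankIn (V : PersistenceModule.{u, w} F 2) (u : Grade 2) : ℕ :=
  finrk ((V.map (homOfLE (Grade.sub_e_le (u - .e 0) 1))).hom.prod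
    (V.map (homOfLE (Grade.sub_e_sub_e_le u 0 1))).hom)

/-- The rank of `V_{u-e₁} × V_{u-e₂} → V_u`. -/
noncomputable def rankOut (V : PersistenceModule.{u, w} F 2) (u : Grade 2) : ℕ :=
  finrk ((V.map (homOfLE (Grade.sub_e_le u 0))).hom.coprod
    (V.map (homOfLE (Grade.sub_e_le u 1))).hom)

lemma finrk_homologyMap_eval_prod {n : ℕ} {V : PersistenceModule.{u, w} F n}
    (P : ProjectiveResolution V) {w w₁ w₂ : Grade n} (h₁ : w ≤ w₁) (h₂ : w ≤ w₂) (i : ℕ) :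
    finrk ((homologyMap (evalComplexMap P.complex h₁) i).hom.prod
      (homologyMap (evalComplexMap P.complex h₂) i).hom) =
    finrk (((evalComplexMap ((ChainComplex.single₀ _).obj V) h₁).f i).hom.prod
      ((evalComplexMap ((ChainComplex.single₀ _).obj V) h₂).f i).hom) := by
  refine finrk_eq_of_comm (homologyEvalEquiv P w i)
    ((homologyEvalEquiv P w₁ i).prodCongr (homologyEvalEquiv P w₂ i)) fun x => ?_
  exact Prod.ext (homologyEvalEquiv_naturality P h₁ i x) (homologyEvalEquiv_naturality P h₂ i x)

lemma finrk_homologyMap_eval_coprod {n : ℕ} {V : PersistenceModule.{u, w} F n}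
    (P : ProjectiveResolution V) {w w₁ w₂ : Grade n} (h₁ : w₁ ≤ w) (h₂ : w₂ ≤ w) (i : ℕ) :
    finrk ((homologyMap (evalComplexMap P.complex h₁) i).hom.coprod
      (homologyMap (evalComplexMap P.complex h₂) i).hom) =
    finrk (((evalComplexMap ((ChainComplex.single₀ _).obj V) h₁).f i).hom.coprod
      ((evalComplexMap ((ChainComplex.single₀ _).obj V) h₂).f i).hom) := by
  refine finrk_eq_of_comm ((homologyEvalEquiv P w₁ i).prodCongr (homologyEvalEquiv P w₂ i))
    (homologyEvalEquiv P w i) fun x => ?_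
  rw [LinearMap.coprod_apply, map_add, homologyEvalEquiv_naturality, homologyEvalEquiv_naturality]
  rfl

/-- The Betti tables are the dimensions of the homology of the Koszul complex
`V_{u-e₁-e₂} → V_{u-e₁} × V_{u-e₂} → V_u`. -/
theorem betti_add_rank [Small.{w} F] (V : PersistenceModule.{u, w} F 2)
    (hV : ∀ w, Module.Finite F (V.obj w)) (u : Grade 2) :
    V.betti 0 u + V.rankOut u = Module.finrank F (V.obj u) ∧
    V.betti 1 u + V.rankOut u + V.rankIn u =
      Module.finrank F (V.obj (u - .e 0)) + Module.finrank F (V.obj (u - .e 1)) ∧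
    V.betti 2 u + V.rankIn u = Module.finrank F (V.obj (u - .e 0 - .e 1)) := by
  let P := projectiveResolution V
  have hb (i : ℕ) : V.betti i u = Module.finrank F
      ((((tensorResidue.{u, w} F u).mapHomologicalComplex _).obj P.complex).homology i :
        ModuleCat.{w} F) :=
    (P.isoLeftDerivedObj (tensorResidue.{u, w} F u) i).toLinearEquiv.finrank_eq
  have hfin (w : Grade 2) (i : ℕ) : Module.Finite F ((evalComplex P.complex w).homology i) := by
    have := hV
    exact finite_homology_eval P w i
  -- The homology of the three evaluated terms vanishes in positive degrees, so `r 1 = r 2 = 0`,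
  -- while `h5` and `h7` force `r 0 = V.rankOut u`. The Betti numbers can then be read off.
  obtain ⟨r, s, h1, h2, h3, h4, h5, h6, h7⟩ :=
    (isKoszulSquare_evalComplex P.complex u).exists_ranks (hfin _) (hfin _) (hfin _) (hfin _)
      (fun _ => rfl) (fun _ => rfl)
  have hnot : ¬ (ComplexShape.down ℕ).Rel 0 ((ComplexShape.down ℕ).next 0) := by simp
  have e0 := finrank_homology_eval_zero P
  have e1 := finrank_homology_eval_succ P
  have g1 := h1 1 0 rfl
  have g2 := h2 0 hnot
  have g3 := h3 1 0 rfl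
  have g3' := h3 2 1 rfl
  have g4 := h4 0 hnot
  have g5 := h5 0
  have g6 := h6 1
  have g6' := h6 2
  have g7 := h7 0
  -- This relation has right-hand side zero. It gives `α 1 = 0`, which `g1` needs in order to
  -- determine `s 1`.
  have g1' := h1 2 1 rfl
  have hα : finrk _ = V.rankIn u := finrk_homologyMap_eval_prod P (Grade.sub_e_le (u - .e 0) 1)
    (Grade.sub_e_sub_e_le u 0 1) 0
  have hβ : finrk _ = V.rankOut u := finrk_homologyMap_eval_coprod P (Grade.sub_e_le u 0)
    (Grade.sub_e_le u 1) 0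
  simp only [e0, e1, hα, hβ, zero_add, ← hb] at g1 g1' g2 g3 g3' g4 g5 g6 g6' g7
  omega

end PersistenceModule

/-! ### Chains of subcomplexes and the Koszul square of a bi-filtration -/

lemma HomologicalComplex.finite_homology {F : Type u} [Field F] {ι : Type*} {c : ComplexShape ι}
    (K : HomologicalComplex (ModuleCat.{w} F) c) (i : ι) [Module.Finite F (K.X i)] :
    Module.Finite F (K.homology i) := by
  have h1 : Module.Finite F (K.cycles i) :=
    Module.Finite.of_injective (K.iCycles i).hom
      ((ModuleCat.mono_iff_injective (K.iCycles i)).1 inferInstance)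
  exact Module.Finite.of_surjective (K.homologyπ i).hom
    ((ModuleCat.epi_iff_surjective (K.homologyπ i)).1 inferInstance)

namespace CellComplex

variable {F : Type u} [Field F] {K : CellComplex.{u, v} F}

namespace Subcomplex

lemma cellsOfDimMap_injective {A B : K.Subcomplex} (h : A ≤ B) (q : ℤ) :
    Function.Injective fun σ : A.CellsOfDim q => (⟨σ.1, h σ.2.1, σ.2.2⟩ : B.CellsOfDim q) :=
  fun _ _ hxy => Subtype.ext (congrArg (fun z => z.1) hxy)

lemma inclusion_injective {A B : K.Subcomplex} (h : A ≤ B) (q : ℤ) :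
    Function.Injective (inclusion h q) :=
  Finsupp.mapDomain_injective (cellsOfDimMap_injective h q)

lemma inclusion_apply_of_mem {A B : K.Subcomplex} (h : A ≤ B) (q : ℤ) (c : A.CellsOfDim q →₀ F)
    (σ : B.CellsOfDim q) (hσ : σ.1 ∈ A.cells) :
    inclusion h q c σ = c ⟨σ.1, hσ, σ.2.2⟩ :=
  Finsupp.mapDomain_apply (cellsOfDimMap_injective h q) c ⟨σ.1, hσ, σ.2.2⟩

lemma inclusion_apply_of_notMem {A B : K.Subcomplex} (h : A ≤ B) (q : ℤ)
    (c : A.CellsOfDim q →₀ F) (σ : B.CellsOfDim q) (hσ : σ.1 ∉ A.cells) :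
    inclusion h q c σ = 0 := by
  refine Finsupp.mapDomain_of_notMem_range _ _ ?_
  rintro ⟨ρ, rfl⟩
  exact hσ ρ.2.1

lemma exists_inclusion_eq {A B : K.Subcomplex} (h : A ≤ B) (q : ℤ) (c : B.CellsOfDim q →₀ F)
    (hc : ∀ σ, σ.1 ∉ A.cells → c σ = 0) : ∃ c', inclusion h q c' = c := by
  refine ⟨Finsupp.equivFunOnFinite.symm fun σ => c ⟨σ.1, h σ.2.1, σ.2.2⟩, ?_⟩
  ext σ
  by_cases hσ : σ.1 ∈ A.cells
  · rw [inclusion_apply_of_mem h q _ σ hσ]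
    rfl
  · rw [inclusion_apply_of_notMem h q _ σ hσ, hc σ hσ]

lemma inclusion_comp_apply {A B C : K.Subcomplex} (h : A ≤ B) (h' : B ≤ C) (q : ℤ)
    (c : A.CellsOfDim q →₀ F) :
    inclusion h' q (inclusion h q c) = inclusion (h.trans h') q c :=
  (Finsupp.mapDomain_comp (f := fun σ : A.CellsOfDim q => (⟨σ.1, h σ.2.1, σ.2.2⟩ : B.CellsOfDim q))
    (g := fun σ : B.CellsOfDim q => (⟨σ.1, h' σ.2.1, σ.2.2⟩ : C.CellsOfDim q))).symm

lemma chainsMap_comp {A B C : K.Subcomplex} (h : A ≤ B) (h' : B ≤ C) :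
    chainsMap h ≫ chainsMap h' = chainsMap (h.trans h') := by
  ext q c : 3
  exact inclusion_comp_apply h h' q c

lemma finite_homology_chains (A : K.Subcomplex) (q : ℤ) :
    Module.Finite F (A.chains.homology q) := by
  have : Module.Finite F (A.chains.X q) :=
    inferInstanceAs (Module.Finite F (A.CellsOfDim q →₀ F))
  exact HomologicalComplex.finite_homology _ _

/-- The chain complex `C_*(B) / C_*(A)`. -/
noncomputable abbrev relativeChains {A B : K.Subcomplex} (h : A ≤ B) :
    ChainComplex (ModuleCat.{max u v} F) ℤ :=
  Limits.cokernel (chainsMap h)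

/-- The projection `C_q(B) → C_q(B) / C_q(A)`. -/
noncomputable def relativeπ {A B : K.Subcomplex} (h : A ≤ B) (q : ℤ) :
    (B.CellsOfDim q →₀ F) →ₗ[F] (relativeChains h).X q :=
  ((Limits.cokernel.π (chainsMap h)).f q).hom

lemma relativeπ_surjective {A B : K.Subcomplex} (h : A ≤ B) (q : ℤ) :
    Function.Surjective (relativeπ h q) :=
  (ModuleCat.epi_iff_surjective ((Limits.cokernel.π (chainsMap h)).f q)).1 inferInstance

lemma relativeπ_inclusion {A B : K.Subcomplex} (h : A ≤ B) (q : ℤ) (c : A.CellsOfDim q →₀ F) :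
    relativeπ h q (inclusion h q c) = 0 :=
  congrArg (fun f => ModuleCat.Hom.hom (HomologicalComplex.Hom.f f q) c)
    (Limits.cokernel.condition (chainsMap h))

lemma exists_of_relativeπ_eq_zero {A B : K.Subcomplex} (h : A ≤ B) (q : ℤ)
    (c : B.CellsOfDim q →₀ F) (hc : relativeπ h q c = 0) : ∃ c', inclusion h q c' = c := by
  have h1 : (ShortComplex.mk _ _ (Limits.cokernel.condition (chainsMap h))).Exact :=
    ShortComplex.exact_of_g_is_cokernel _ (Limits.cokernelIsCokernel _)
  exact (ShortComplex.moduleCat_exact_iff _).1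
    (h1.map (HomologicalComplex.eval _ (ComplexShape.down ℤ) q)) c hc

/-- The relative complex is an abstract cokernel; this makes vanishing in it a condition on
coefficients. -/
lemma relativeπ_eq_zero_iff {A B : K.Subcomplex} (h : A ≤ B) (q : ℤ)
    (c : B.CellsOfDim q →₀ F) : relativeπ h q c = 0 ↔ ∀ σ, σ.1 ∉ A.cells → c σ = 0 := by
  constructor
  · intro hc σ hσ
    obtain ⟨c', rfl⟩ := exists_of_relativeπ_eq_zero h q c hc
    exact inclusion_apply_of_notMem h q c' σ hσ
  · intro hc
    obtain ⟨c', rfl⟩ := exists_inclusion_eq h q c hc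
    exact relativeπ_inclusion h q c'

end Subcomplex

namespace MultiFiltration

/-- From any `u` with `σ` in K^u, subtract basis vectors as long as `σ` remains. The lower bound `a`
makes the descent stop, and the uniqueness in `oneCritical` says that it always stops at the same
grade. The induction is on a bound for the sum of the coordinates of `u - a`. -/
lemma exists_grade {n : ℕ} (𝒦 : K.MultiFiltration n) (σ : K.Cell) :
    ∃ g : Grade n, ∀ u, σ ∈ (𝒦.sub u).cells ↔ g ≤ u := by
  obtain ⟨a, ha⟩ := 𝒦.empty
  obtain ⟨g, ⟨hg, -⟩, huniq⟩ := 𝒦.oneCritical σ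
  refine ⟨g, fun u => ⟨?_, fun h => 𝒦.monotone h hg⟩⟩
  have key (k : ℕ) : ∀ u : Grade n, ∑ i, (u i - a i : ℤ) ≤ k → σ ∈ (𝒦.sub u).cells → g ≤ u := by
    induction k with
    | zero =>
      intro u hk hu
      refine le_of_eq (huniq u ⟨hu, fun i hi => ?_⟩).symm
      have h1 : a ≤ u - Grade.e i := by
        by_contra h1
        rw [ha _ h1] at hi
        exact hi
      have h2 := Grade.le_sub_e_iff.1 h1
      have h3 : ∑ i, (u i - a i : ℤ) > 0 :=
        Finset.sum_pos' (fun j _ => sub_nonneg.2 (h2.1 j)) ⟨i, Finset.mem_univ i, sub_pos.2 h2.2⟩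
      omega
    | succ k ih =>
      intro u hk hu
      by_cases h : ∀ i, σ ∉ (𝒦.sub (u - Grade.e i)).cells
      · exact (huniq u ⟨hu, h⟩).ge
      · push Not at h
        obtain ⟨i, hi⟩ := h
        refine (ih _ ?_ hi).trans (Grade.sub_e_le u i)
        have h1 : ∑ j, ((u - Grade.e i) j - a j : ℤ) = ∑ j, (u j - a j : ℤ) - 1 := by
          have h2 (j : Fin n) : ((u - Grade.e i) j - a j : ℤ) =
              (u j - a j) - (Pi.single i 1 : Fin n → ℤ) j :=
            sub_right_comm (u j : ℤ) _ _
          rw [Finset.sum_congr rfl fun j _ => h2 j, Finset.sum_sub_distrib,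
            Finset.sum_pi_single', if_pos (Finset.mem_univ i)]
        rw [h1]
        push_cast at hk
        omega
  exact key (∑ i, (u i - a i : ℤ)).toNat u (Int.self_le_toNat _)

lemma finite_persistentHomology {n : ℕ} (𝒦 : K.MultiFiltration n) (q : ℤ) (u : Grade n) :
    Module.Finite F ((𝒦.persistentHomology q).obj u) :=
  Subcomplex.finite_homology_chains (𝒦.sub u) q

variable (𝒦 : K.MultiFiltration 2)

lemma betti_add_rank (q : ℤ) (u : Grade 2) :
    𝒦.betti 0 q u + PersistenceModule.rankOut (𝒦.persistentHomology q) u =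
      Module.finrank F ((𝒦.sub u).chains.homology q) ∧
    𝒦.betti 1 q u + PersistenceModule.rankOut (𝒦.persistentHomology q) u +
        PersistenceModule.rankIn (𝒦.persistentHomology q) u =
      Module.finrank F ((𝒦.sub (u - .e 0)).chains.homology q) +
        Module.finrank F ((𝒦.sub (u - .e 1)).chains.homology q) ∧
    𝒦.betti 2 q u + PersistenceModule.rankIn (𝒦.persistentHomology q) u =
      Module.finrank F ((𝒦.sub (u - .e 0 - .e 1)).chains.homology q) :=
  PersistenceModule.betti_add_rank (𝒦.persistentHomology q) (𝒦.finite_persistentHomology q) u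

lemma mem_previous {u : Grade 2} {σ : K.Cell} : σ ∈ (𝒦.previous u).cells ↔
    σ ∈ (𝒦.sub (u - .e 0)).cells ∨ σ ∈ (𝒦.sub (u - .e 1)).cells :=
  Set.mem_iUnion.trans Fin.exists_fin_two

/-- The pullback property is K^{u-e₁} ∩ K^{u-e₂} = K^{u-e₁-e₂}, which follows because the grades at
which a cell is present are those above its entrance grade. -/
lemma isKoszulSquare_chains (u : Grade 2) :
    IsKoszulSquare (Subcomplex.chainsMap (𝒦.monotone (Grade.sub_e_le (u - .e 0) 1)))
      (Subcomplex.chainsMap (𝒦.monotone (Grade.sub_e_sub_e_le u 0 1)))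
      (Subcomplex.chainsMap (𝒦.monotone (Grade.sub_e_le u 0)))
      (Subcomplex.chainsMap (𝒦.monotone (Grade.sub_e_le u 1)))
      (Limits.cokernel.π (Subcomplex.chainsMap (𝒦.previous_le u))) := by
  have hle0 : 𝒦.sub (u - .e 0) ≤ 𝒦.previous u := fun σ hσ => (𝒦.mem_previous).2 (Or.inl hσ)
  have hle1 : 𝒦.sub (u - .e 1) ≤ 𝒦.previous u := fun σ hσ => (𝒦.mem_previous).2 (Or.inr hσ)
  refine ⟨?_, ?_, ?_, fun q c hc _ => ?_, fun q x y hxy => ?_, fun q z hz => ?_, fun q => ?_⟩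
  · rw [Subcomplex.chainsMap_comp, Subcomplex.chainsMap_comp]
  · rw [← Subcomplex.chainsMap_comp hle0 (𝒦.previous_le u), Category.assoc,
      Limits.cokernel.condition, Limits.comp_zero]
  · rw [← Subcomplex.chainsMap_comp hle1 (𝒦.previous_le u), Category.assoc,
      Limits.cokernel.condition, Limits.comp_zero]
  · exact (injective_iff_map_eq_zero (Subcomplex.inclusion
      (𝒦.monotone (Grade.sub_e_le (u - Grade.e 0) 1)) q)).1 (Subcomplex.inclusion_injective _ q) c hc
  · change ((𝒦.sub (u - .e 0)).CellsOfDim q →₀ F) at x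
    change ((𝒦.sub (u - .e 1)).CellsOfDim q →₀ F) at y
    replace hxy : Subcomplex.inclusion (𝒦.monotone (Grade.sub_e_le u 0)) q x =
      Subcomplex.inclusion (𝒦.monotone (Grade.sub_e_le u 1)) q y := hxy
    obtain ⟨z, hz⟩ := Subcomplex.exists_inclusion_eq
      (𝒦.monotone (Grade.sub_e_le (u - .e 0) 1)) q x fun σ hσ => by
        have h1 : σ.1 ∉ (𝒦.sub (u - .e 1)).cells := fun h1 => by
          obtain ⟨g, hg⟩ := 𝒦.exists_grade σ.1
          exact hσ ((hg _).2 (Grade.le_sub_e_sub_e (by decide) ((hg _).1 σ.2.1) ((hg _).1 h1)))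
        have h2 := DFunLike.congr_fun hxy
          ⟨σ.1, 𝒦.monotone (Grade.sub_e_le u 0) σ.2.1, σ.2.2⟩
        exact (Subcomplex.inclusion_apply_of_mem (𝒦.monotone (Grade.sub_e_le u 0)) q x
          ⟨σ.1, 𝒦.monotone (Grade.sub_e_le u 0) σ.2.1, σ.2.2⟩ σ.2.1).symm.trans
          (h2.trans (Subcomplex.inclusion_apply_of_notMem _ q y _ h1))
    refine ⟨z, hz, Subcomplex.inclusion_injective (𝒦.monotone (Grade.sub_e_le u 1)) q ?_⟩
    rw [← hxy, ← hz, Subcomplex.inclusion_comp_apply]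
    exact Subcomplex.inclusion_comp_apply (𝒦.monotone (Grade.sub_e_sub_e_le u 0 1)) _ q z
  · classical
    change ((𝒦.sub u).CellsOfDim q →₀ F) at z
    have h0 := (Subcomplex.relativeπ_eq_zero_iff (𝒦.previous_le u) q z).1 hz
    -- A chain on the union is split: `x` takes the cells of K^{u-e₁}, and `y` the others, which lie
    -- in K^{u-e₂}.
    obtain ⟨x, hx⟩ := Subcomplex.exists_inclusion_eq (𝒦.monotone (Grade.sub_e_le u 0)) q
      (z.filter fun σ => σ.1 ∈ (𝒦.sub (u - .e 0)).cells)
      fun σ hσ => Finsupp.filter_apply_neg _ _ hσ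
    obtain ⟨y, hy⟩ := Subcomplex.exists_inclusion_eq (𝒦.monotone (Grade.sub_e_le u 1)) q
      (z.filter fun σ => ¬ σ.1 ∈ (𝒦.sub (u - .e 0)).cells) fun σ hσ => by
        by_cases h1 : σ.1 ∈ (𝒦.sub (u - .e 0)).cells
        · exact Finsupp.filter_apply_neg _ _ (not_not.2 h1)
        · exact (Finsupp.filter_apply_pos
            (fun σ : (𝒦.sub u).CellsOfDim q => ¬ σ.1 ∈ (𝒦.sub (u - .e 0)).cells) z h1).trans
            (h0 σ fun h => (𝒦.mem_previous.1 h).elim h1 hσ)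
    refine ⟨x, y, ?_⟩
    rw [← Finsupp.filter_add_filter_not z fun σ => σ.1 ∈ (𝒦.sub (u - .e 0)).cells]
    exact congrArg₂ _ hx.symm hy.symm
  · exact Subcomplex.relativeπ_surjective _ q

/-- The dimension of the relative homology is bounded below and above in terms of the Betti
tables. -/
theorem finrank_relHomology_bounds (q : ℤ) (u : Grade 2) :
    𝒦.betti 0 q u + 𝒦.betti 1 (q - 1) u ≤
        Module.finrank F (𝒦.relHomology q u) + 𝒦.betti 2 (q - 1) u ∧
      Module.finrank F (𝒦.relHomology q u) ≤
        𝒦.betti 0 q u + 𝒦.betti 1 (q - 1) u + 𝒦.betti 2 (q - 2) u := by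
  obtain ⟨r, s, h1, -, h3, -, h5, -, h7⟩ := (𝒦.isKoszulSquare_chains u).exists_ranks
    (α := fun q => PersistenceModule.rankIn (𝒦.persistentHomology q) u)
    (β := fun q => PersistenceModule.rankOut (𝒦.persistentHomology q) u)
    (Subcomplex.finite_homology_chains _) (Subcomplex.finite_homology_chains _)
    (Subcomplex.finite_homology_chains _) (Subcomplex.finite_homology_chains _)
    (fun _ => rfl) (fun _ => rfl)
  have b0 := 𝒦.betti_add_rank q u
  have b1 := 𝒦.betti_add_rank (q - 1) u
  have b2 := 𝒦.betti_add_rank (q - 2) u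
  have g1 := h1 q (q - 1) (by simp)
  have g1' := h1 (q - 1) (q - 2) (by simp; ring)
  have g3 : Module.finrank F (𝒦.relHomology q u) + r q + r (q - 1) = _ := h3 q (q - 1) (by simp)
  have g5 := h5 q
  have g5' := h5 (q - 1)
  have g7 := h7 q
  have g7' := h7 (q - 1)
  -- Eliminating `s` gives the formula for the dimension with corrections r_q - β_q and r_{q-1} -
  -- β_{q-1}; `g5`, `g5'` make them nonnegative, `g7`, `g7'` bound them by ξ_2^{q-1} and ξ_2^{q-2}.
  -- In the lower bound the last term cancels ξ_2^{q-2}.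
  omega

end MultiFiltration

end CellComplex

/-! ### Dimension estimates for homology -/

namespace HomologicalComplex

variable {F : Type u} [Field F] {ι : Type*} {c : ComplexShape ι}
  (X : HomologicalComplex (ModuleCat.{w} F) c)

lemma iCycles_injective (j : ι) : Function.Injective (X.iCycles j).hom :=
  (ModuleCat.mono_iff_injective (X.iCycles j)).1 inferInstance

lemma homologyπ_surjective (j : ι) : Function.Surjective (X.homologyπ j).hom :=
  (ModuleCat.epi_iff_surjective (X.homologyπ j)).1 inferInstance

/-- If `W` maps to the `j`-cycles, surjectively up to boundaries, then the dimension of the homology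
is bounded by the rank of any linear map on `W` whose kernel is mapped to zero. -/
lemma finrank_homology_le {i j k : ι} (hk : c.next j = k) {W : Type w}
    [AddCommGroup W] [Module F W] [Module.Finite F W] {M : Type*} [AddCommGroup M] [Module F M]
    [Module.Finite F M] (φ : W →ₗ[F] X.X j) (hφ : ∀ x, (X.d j k).hom (φ x) = 0)
    (ψ : W →ₗ[F] M) (hψ : ∀ x, ψ x = 0 → φ x = 0)
    (h : ∀ z, (X.d j k).hom z = 0 → ∃ (x : W) (y : X.X i), z = φ x + (X.d i j).hom y) :
    Module.finrank F (X.homology j) ≤ Module.finrank F M := by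
  let l : ModuleCat.of F W ⟶ X.cycles j :=
    X.liftCycles (ModuleCat.ofHom φ) k hk (ModuleCat.hom_ext (LinearMap.ext hφ))
  have hl (x : W) : (X.iCycles j).hom (l.hom x) = φ x :=
    congrArg (fun f => ModuleCat.Hom.hom f x) (X.liftCycles_i (ModuleCat.ofHom φ) k hk _)
  let Φ : W →ₗ[F] X.homology j := (X.homologyπ j).hom ∘ₗ l.hom
  have hsurj : Function.Surjective Φ := by
    intro z
    obtain ⟨z, rfl⟩ := X.homologyπ_surjective j z
    obtain ⟨x, y, hxy⟩ := h ((X.iCycles j).hom z)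
      (congrArg (fun f => ModuleCat.Hom.hom f z) (X.iCycles_d j k))
    have h1 : z = l.hom x + (X.toCycles i j).hom y := by
      apply X.iCycles_injective j
      rw [map_add, hl, hxy]
      exact congrArg (fun t => φ x + t)
        (congrArg (fun f => ModuleCat.Hom.hom f y) (X.toCycles_i i j)).symm
    refine ⟨x, ?_⟩
    rw [h1, map_add]
    have h2 : (X.homologyπ j).hom ((X.toCycles i j).hom y) = 0 :=
      congrArg (fun f => ModuleCat.Hom.hom f y) (X.toCycles_comp_homologyπ i j)
    rw [h2, add_zero]
    rfl
  have hker : ker ψ ≤ ker Φ := fun x hx => by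
    have h0 : l.hom x = 0 := X.iCycles_injective j (by rw [hl, hψ x hx, map_zero])
    change (X.homologyπ j).hom (l.hom x) = 0
    rw [h0, map_zero]
  have e1 := Φ.finrank_range_add_finrank_ker
  have e2 := ψ.finrank_range_add_finrank_ker
  have e3 := Submodule.finrank_mono hker
  have e4 := Submodule.finrank_le (range ψ)
  rw [range_eq_top.2 hsurj, finrank_top] at e1
  omega

/-- The incoming and outgoing differentials have ranks at most the dimensions of the neighbouring
terms. This yields lower bounds for homology from cell counts. -/
lemma finrank_X_le {i j k : ι} (hi : c.prev j = i) (hk : c.next j = k)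
    [Module.Finite F (X.X i)] [Module.Finite F (X.X j)] [Module.Finite F (X.X k)] :
    Module.finrank F (X.X j) ≤
      Module.finrank F (X.homology j) + Module.finrank F (X.X i) + Module.finrank F (X.X k) := by
  have h1 : (ShortComplex.mk _ _ (X.iCycles_d j k)).Exact :=
    ShortComplex.exact_of_f_is_kernel _ (X.cyclesIsKernel j k hk)
  have h2 : (ShortComplex.mk _ _ (X.toCycles_comp_homologyπ i j)).Exact :=
    ShortComplex.exact_of_g_is_cokernel _ (X.homologyIsCokernel i j hi)
  have hfin : Module.Finite F (X.cycles j) := Module.Finite.of_injective _ (X.iCycles_injective j)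
  have e1 := finrk_add_finrk_of_exact (LinearMap.exact_iff.2 h1.moduleCat_range_eq_ker.symm)
  have e2 := finrk_add_finrk_of_exact (LinearMap.exact_iff.2 h2.moduleCat_range_eq_ker.symm)
  have e3 := finrk_of_injective (X.iCycles_injective j)
  have e4 := finrk_of_surjective (X.homologyπ_surjective j)
  have e5 := finrk_le (X.d j k).hom
  have e6 : finrk (X.toCycles i j).hom ≤ _ := LinearMap.finrank_range_le _
  dsimp only at e1 e2
  omega

lemma finrank_homology_eq_zero_of_injective {j k : ι}
    (h : Function.Injective (X.d j k).hom) : Module.finrank F (X.homology j) = 0 := by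
  have h1 : Subsingleton (X.cycles j) := ⟨fun x y => X.iCycles_injective j <| h <| by
    have h0 (z : X.cycles j) : (X.d j k).hom ((X.iCycles j).hom z) = 0 :=
      congrArg (fun f => ModuleCat.Hom.hom f z) (X.iCycles_d j k)
    rw [h0, h0]⟩
  have := (X.homologyπ_surjective j).subsingleton
  exact Module.finrank_zero_of_subsingleton

lemma finrank_homology_le_finrank_X (j : ι) [Module.Finite F (X.X j)] :
    Module.finrank F (X.homology j) ≤ Module.finrank F (X.X j) := by
  have hfin : Module.Finite F (X.cycles j) := Module.Finite.of_injective _ (X.iCycles_injective j)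
  exact (LinearMap.finrank_le_finrank_of_surjective (X.homologyπ_surjective j)).trans
    (LinearMap.finrank_le_finrank_of_injective (X.iCycles_injective j))

end HomologicalComplex

/-! ### The weak Morse inequality -/

namespace CellComplex

variable {F : Type u} [Field F] {K : CellComplex.{u, v} F}

namespace Subcomplex

variable {A B : K.Subcomplex} (h : A ≤ B)

/-- The coefficients of a chain at the cells in a given set. -/
noncomputable def restrict (B : K.Subcomplex) (q : ℤ) (s : Set K.Cell) :
    (B.CellsOfDim q →₀ F) →ₗ[F] ({σ : B.CellsOfDim q // σ.1 ∈ s} → F) :=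
  LinearMap.pi fun σ => Finsupp.lapply σ.1

lemma restrict_surjective (B : K.Subcomplex) (q : ℤ) (s : Set K.Cell) :
    Function.Surjective (restrict B q s) := by
  classical
  intro f
  refine ⟨Finsupp.equivFunOnFinite.symm fun σ => if hσ : σ.1 ∈ s then f ⟨σ, hσ⟩ else 0, ?_⟩
  ext σ
  exact dif_pos σ.2

lemma finrank_coefficients (B : K.Subcomplex) (q : ℤ) (s : Set K.Cell) :
    Module.finrank F ({σ : B.CellsOfDim q // σ.1 ∈ s} → F) =
      {σ | σ ∈ s ∧ K.dim σ = q ∧ σ ∈ B.cells}.ncard := by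
  classical
  rw [Module.finrank_fintype_fun_eq_card, ← Nat.card_eq_fintype_card, ← Nat.card_coe_set_eq]
  exact Nat.card_congr
    { toFun := fun σ => ⟨σ.1.1, σ.2, σ.1.2.2, σ.1.2.1⟩
      invFun := fun σ => ⟨⟨σ.1, σ.2.2.2, σ.2.2.1⟩, σ.2.1⟩ }

lemma finrank_relativeChains (q : ℤ) : Module.finrank F ((relativeChains h).X q) =
    {σ | σ ∉ A.cells ∧ K.dim σ = q ∧ σ ∈ B.cells}.ncard := by
  refine Eq.trans ?_ (finrank_coefficients B q A.cellsᶜ)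
  have hker : ker (relativeπ h q) = ker (restrict B q A.cellsᶜ) := by
    ext c
    rw [LinearMap.mem_ker, LinearMap.mem_ker, relativeπ_eq_zero_iff]
    exact ⟨fun hc => funext fun σ => hc σ.1 σ.2, fun hc σ hσ => congrFun hc ⟨σ, hσ⟩⟩
  exact (((relativeπ h q).quotKerEquivOfSurjective (relativeπ_surjective h q)).symm ≪≫ₗ
    Submodule.quotEquivOfEq _ _ hker ≪≫ₗ
    (restrict B q A.cellsᶜ).quotKerEquivOfSurjective (restrict_surjective B q _)).finrank_eq

lemma finite_relativeChains (q : ℤ) : Module.Finite F ((relativeChains h).X q) :=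
  Module.Finite.of_surjective _ (relativeπ_surjective h q)

lemma d_relativeπ (i j : ℤ) (c : B.CellsOfDim i →₀ F) :
    ((relativeChains h).d i j).hom (relativeπ h i c) = relativeπ h j (B.boundary i j c) :=
  congrArg (fun f => ModuleCat.Hom.hom f c) ((Limits.cokernel.π (chainsMap h)).comm i j)

end Subcomplex

namespace DiscreteVectorField

variable {V : K.DiscreteVectorField}

/-- A chain supported on the heads `τ` of the vectors `(σ, τ)` of a discrete gradient is zero if its
boundary vanishes at the corresponding tails `σ`. -/
lemma IsGradient.eq_zero_of_boundary (hV : V.IsGradient) (B : K.Subcomplex) (i j : ℤ)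
    (c : B.CellsOfDim i →₀ F) (hc : ∀ τ, c τ ≠ 0 → ∃ σ : B.CellsOfDim j, (σ.1, τ.1) ∈ V.pairs)
    (hd : ∀ (σ : B.CellsOfDim j) (τ : B.CellsOfDim i), (σ.1, τ.1) ∈ V.pairs → c τ ≠ 0 →
      B.boundary i j c σ = 0) : c = 0 := by
  by_contra hne
  obtain ⟨τ₀, hτ₀⟩ := Finsupp.ne_iff.1 hne
  have : IsTrans K.Cell (Relation.TransGen V.Step) := ⟨fun _ _ _ => Relation.TransGen.trans⟩
  have : Std.Irrefl (Relation.TransGen V.Step) := ⟨hV⟩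
  have hwf : WellFounded (Relation.TransGen V.Step) := Finite.wellFounded_of_trans_of_irrefl _
  obtain ⟨σ₀, hσ₀⟩ := hc τ₀ hτ₀
  -- Choose a tail `σ` of the support that no `V`-path from another such tail reaches. If a second
  -- head in the support had `σ` as a facet, its tail would step to `σ`. So only `τ` contributes to
  -- the boundary at `σ`, and that coefficient is nonzero.
  obtain ⟨σ, ⟨σ', rfl, τ, hτ, hcτ⟩, hmin⟩ := hwf.has_min
    {σ | ∃ σ' : B.CellsOfDim j, σ'.1 = σ ∧ ∃ τ : B.CellsOfDim i, (σ, τ.1) ∈ V.pairs ∧ c τ ≠ 0}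
    ⟨σ₀.1, σ₀, rfl, τ₀, hσ₀, hτ₀⟩
  have h1 := hd σ' τ hτ hcτ
  rw [Subcomplex.boundary_apply, Finsupp.sum_eq_single τ] at h1
  · exact mul_ne_zero hcτ (V.isFacet _ _ hτ) h1
  · intro τ' hcτ' hne'
    by_contra h2
    obtain ⟨ρ, hρ⟩ := hc τ' hcτ'
    refine hmin ρ.1 ⟨ρ, rfl, τ', hρ, hcτ'⟩ (.single ⟨τ'.1, hρ, right_ne_zero_of_mul h2, ?_⟩)
    intro h3
    rw [← h3] at hρ
    exact hne' (Subtype.ext (V.eq_of_fst _ _ _ hρ hτ))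
  · simp

/-- The boundary of a chain in `B` can be prescribed arbitrarily at the tails of the vectors. -/
lemma IsGradient.exists_boundary_eq (hV : V.IsGradient) (B : K.Subcomplex) (q : ℤ)
    (hB : ∀ σ τ, (σ, τ) ∈ V.pairs → (σ ∈ B.cells ↔ τ ∈ B.cells)) (c : B.CellsOfDim q →₀ F) :
    ∃ y : B.CellsOfDim (q + 1) →₀ F, ∀ σ : B.CellsOfDim q, (∃ τ, (σ.1, τ) ∈ V.pairs) →
      B.boundary (q + 1) q y σ = c σ := by
  classical
  let s : Set K.Cell := {σ | ∃ τ, (σ, τ) ∈ V.pairs}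
  let S := {σ : B.CellsOfDim q // σ.1 ∈ s}
  choose t ht using fun σ : S => σ.2
  let T : S → B.CellsOfDim (q + 1) := fun σ => ⟨t σ, (hB _ _ (ht σ)).1 σ.1.2.1, by
    rw [K.dim_of_incidence _ _ (V.isFacet _ _ (ht σ)), σ.1.2.2]⟩
  have hT (σ : S) : (σ.1.1, (T σ).1) ∈ V.pairs := ht σ
  have hTinj : Function.Injective T := fun σ σ' h => by
    have h1 := hT σ
    rw [h] at h1
    exact Subtype.ext (Subtype.ext (V.eq_of_snd _ _ _ h1 (hT σ')))
  -- `L` is the square block of the boundary with columns the heads and rows the tails; acyclicity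
  -- makes it injective, hence surjective.
  let L : (S →₀ F) →ₗ[F] (S → F) := Subcomplex.restrict B q s ∘ₗ B.boundary (q + 1) q ∘ₗ
    Finsupp.lmapDomain F F T
  have hinj : Function.Injective L := by
    rw [injective_iff_map_eq_zero]
    intro y hy
    refine Finsupp.mapDomain_injective hTinj (Eq.trans ?_ Finsupp.mapDomain_zero.symm)
    have hrange (τ) (hτ : Finsupp.mapDomain T y τ ≠ 0) : ∃ σ : S, T σ = τ := by
      by_contra h
      exact hτ (Finsupp.mapDomain_of_notMem_range _ _ fun ⟨σ, hσ⟩ => h ⟨σ, hσ⟩)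
    refine hV.eq_zero_of_boundary B (q + 1) q _ (fun τ hτ => ?_) (fun σ τ hστ hτ => ?_)
    · obtain ⟨σ, rfl⟩ := hrange τ hτ
      exact ⟨σ.1, hT σ⟩
    · exact congrFun hy ⟨σ, τ.1, hστ⟩
  have hsurj : Function.Surjective L := by
    refine (LinearMap.injective_iff_surjective_of_finrank_eq_finrank ?_).1 hinj
    exact (Finsupp.linearEquivFunOnFinite F F S).finrank_eq
  obtain ⟨y, hy⟩ := hsurj (Subcomplex.restrict B q s c)
  exact ⟨Finsupp.mapDomain T y, fun σ hσ => congrFun hy ⟨σ, hσ⟩⟩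

/-- The weak Morse inequality for a pair of subcomplexes. -/
theorem IsGradient.finrank_relativeHomology_le (hV : V.IsGradient) {A B : K.Subcomplex}
    (h : A ≤ B) (hA : ∀ σ τ, (σ, τ) ∈ V.pairs → (σ ∈ A.cells ↔ τ ∈ A.cells))
    (hB : ∀ σ τ, (σ, τ) ∈ V.pairs → (σ ∈ B.cells ↔ τ ∈ B.cells)) (q : ℤ) :
    Module.finrank F (Subcomplex.relativeHomology h q) ≤
      {σ | (V.IsCritical σ ∧ σ ∉ A.cells) ∧ K.dim σ = q ∧ σ ∈ B.cells}.ncard := by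
  classical
  let s : Set K.Cell := {σ | V.IsCritical σ ∧ σ ∉ A.cells}
  let tails : Set K.Cell := {σ | ∃ τ, (σ, τ) ∈ V.pairs}
  -- `W` consists of the relative cycles that vanish at all tails. Subtracting a boundary brings
  -- every relative cycle into `W`, and modulo chains of `A` an element of `W` is determined by its
  -- critical coefficients.
  let W : Submodule F (B.CellsOfDim q →₀ F) :=
    ker (Subcomplex.restrict B q tails) ⊓
      ker (Subcomplex.relativeπ h (q - 1) ∘ₗ B.boundary q (q - 1))
  refine le_of_le_of_eq ((Subcomplex.relativeChains h).finrank_homology_le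
    (i := q + 1) (j := q) (k := q - 1) (W := W) (by simp) (Subcomplex.relativeπ h q ∘ₗ W.subtype)
    (fun x => ?_) (Subcomplex.restrict B q s ∘ₗ W.subtype) (fun x hx => ?_) fun z hz => ?_)
    (Subcomplex.finrank_coefficients B q s)
  · exact (Subcomplex.d_relativeπ h q (q - 1) x.1).trans x.2.2
  · obtain ⟨c, hc1, hc2⟩ := x
    replace hc1 (σ : B.CellsOfDim q) (hσ : ∃ τ, (σ.1, τ) ∈ V.pairs) : c σ = 0 :=
      congrFun hc1 ⟨σ, hσ⟩
    replace hc2 := (Subcomplex.relativeπ_eq_zero_iff h (q - 1) (B.boundary q (q - 1) c)).1 hc2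
    replace hx (σ : B.CellsOfDim q) (hσ : V.IsCritical σ.1 ∧ σ.1 ∉ A.cells) : c σ = 0 :=
      congrFun hx ⟨σ, hσ⟩
    refine (Subcomplex.relativeπ_eq_zero_iff h q c).2 ?_
    -- Dropping the part in `A` changes the boundary only inside `A`. The support of `c'` consists
    -- of heads outside `A`, and by consistency their tails also lie outside `A`.
    let c' := c.filter fun σ => ¬ σ.1 ∈ A.cells
    have hc'1 (σ : B.CellsOfDim q) (hσ : σ.1 ∉ A.cells) : c' σ = c σ := Finsupp.filter_apply_pos
      (fun σ : B.CellsOfDim q => ¬ σ.1 ∈ A.cells) c hσ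
    have hc'2 (σ : B.CellsOfDim q) (hσ : σ.1 ∈ A.cells) : c' σ = 0 := Finsupp.filter_apply_neg
      (fun σ : B.CellsOfDim q => ¬ σ.1 ∈ A.cells) c (not_not.2 hσ)
    suffices h0 : c' = 0 by
      intro σ hσ
      rw [← hc'1 σ hσ, h0, Finsupp.zero_apply]
    have hnot (τ) (hτ : c' τ ≠ 0) : τ.1 ∉ A.cells := fun h1 => hτ (hc'2 τ h1)
    refine hV.eq_zero_of_boundary B q (q - 1) c' (fun τ hτ => ?_) (fun σ τ hστ hτ => ?_)
    · have hτA := hnot τ hτ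
      rw [hc'1 τ hτA] at hτ
      have h1 : ¬ V.IsCritical τ.1 := fun h1 => hτ (hx τ ⟨h1, hτA⟩)
      obtain ⟨ρ, hρ⟩ := not_forall.1 h1
      have h2 : (ρ, τ.1) ∈ V.pairs := by
        by_contra h2
        refine hρ ⟨fun h3 => hτ (hc1 τ ⟨ρ, h3⟩), h2⟩
      have h4 := K.dim_of_incidence _ _ (V.isFacet _ _ h2)
      rw [τ.2.2] at h4
      exact ⟨⟨ρ, (hB _ _ h2).2 τ.2.1, by omega⟩, h2⟩
    · have hσA : σ.1 ∉ A.cells := fun h1 => hnot τ hτ ((hA _ _ hστ).1 h1)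
      rw [← hc2 σ hσA, ← sub_eq_zero, ← Finsupp.sub_apply, ← map_sub]
      obtain ⟨a, ha⟩ := Subcomplex.exists_inclusion_eq h q (c' - c) fun ρ hρ => by
        rw [Finsupp.sub_apply, hc'1 ρ hρ, sub_self]
      rw [← ha, ← LinearMap.comp_apply, Subcomplex.boundary_inclusion]
      exact Subcomplex.inclusion_apply_of_notMem h _ _ σ hσA
  · obtain ⟨c, rfl⟩ := Subcomplex.relativeπ_surjective h q z
    rw [Subcomplex.d_relativeπ] at hz
    obtain ⟨y, hy⟩ := hV.exists_boundary_eq B q hB c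
    have hmem : c - B.boundary (q + 1) q y ∈ W := by
      refine ⟨funext fun σ => ?_, ?_⟩
      · exact sub_eq_zero.2 (hy σ.1 σ.2).symm
      · change Subcomplex.relativeπ h (q - 1) (B.boundary q (q - 1) _) = 0
        have h1 : B.boundary q (q - 1) (B.boundary (q + 1) q y) = 0 :=
          LinearMap.congr_fun (B.boundary_comp (q + 1) q (q - 1) rfl) y
        rw [map_sub, h1, sub_zero, hz]
    refine ⟨⟨_, hmem⟩, Subcomplex.relativeπ h (q + 1) y, ?_⟩
    rw [Subcomplex.d_relativeπ]
    change _ = Subcomplex.relativeπ h q (c - B.boundary (q + 1) q y) + _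
    rw [map_sub, sub_add_cancel]

/-- The weak Morse inequality. -/
theorem IsGradient.finrank_relHomology_le_morseNumber (hV : V.IsGradient) {n : ℕ}
    {𝒦 : K.MultiFiltration n} (hK : V.IsConsistent 𝒦) (q : ℤ) (u : Grade n) :
    Module.finrank F (𝒦.relHomology q u) ≤ V.morseNumber 𝒦 q u := by
  refine (hV.finrank_relativeHomology_le (𝒦.previous_le u) (fun σ τ h => ?_)
    (fun σ τ h => hK σ τ h u) q).trans_eq ?_
  · exact (Set.mem_iUnion.trans (exists_congr fun i => hK σ τ h _)).trans Set.mem_iUnion.symm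
  · rw [morseNumber]
    congr 1
    ext σ
    simp only [Set.mem_ofPred_eq]
    tauto

end DiscreteVectorField

end CellComplex

/-! ### Filtrations by entrance grades and the empty vector field -/

namespace CellComplex

variable {F : Type u} [Field F] {K : CellComplex.{u, v} F}

namespace Subcomplex

lemma finrank_chains (A : K.Subcomplex) (q : ℤ) :
    Module.finrank F (A.chains.X q) = Nat.card (A.CellsOfDim q) := by
  classical
  rw [Nat.card_eq_fintype_card]
  exact Module.finrank_finsupp_self F

lemma finite_chains (A : K.Subcomplex) (q : ℤ) : Module.Finite F (A.chains.X q) :=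
  inferInstanceAs (Module.Finite F (A.CellsOfDim q →₀ F))

/-- If `A` has at most one `i`-cell, and that cell has a facet, then `Hᵢ(A) = 0`. -/
lemma finrank_homology_eq_zero_of_subsingleton (A : K.Subcomplex) (i : ℤ)
    (hA : Subsingleton (A.CellsOfDim i)) (h : ∀ τ : A.CellsOfDim i, ∃ σ, K.IsFacet σ τ.1) :
    Module.finrank F (A.chains.homology i) = 0 := by
  refine A.chains.finrank_homology_eq_zero_of_injective (k := i - 1) ?_
  change Function.Injective (A.boundary i (i - 1))
  rw [injective_iff_map_eq_zero]
  intro c hc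
  ext τ
  obtain ⟨σ, hσ⟩ := h τ
  have h1 := K.dim_of_incidence _ _ hσ
  rw [τ.2.2] at h1
  have h2 := DFunLike.congr_fun hc ⟨σ, A.facet_mem hσ τ.2.1, by omega⟩
  have h3 : c = Finsupp.single τ (c τ) := by
    ext τ'
    rw [Subsingleton.elim τ' τ, Finsupp.single_eq_same]
  rw [h3, boundary_single_apply] at h2
  exact (mul_eq_zero.1 h2).resolve_right hσ

end Subcomplex

namespace MultiFiltration

/-- The filtration in which each cell `σ` enters at the grade `g σ`. -/
def ofGrade {n : ℕ} (g : K.Cell → Grade n) (hg : ∀ σ τ, K.IsFacet σ τ → g σ ≤ g τ) :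
    K.MultiFiltration n where
  sub u := { cells := {σ | g σ ≤ u}, facet_mem := fun σ τ h hτ => (hg σ τ h).trans hτ }
  monotone _ _ h _ hσ := le_trans hσ h
  empty := by
    choose a ha using fun i => (Set.finite_range fun σ => (g σ i : ℤ)).bddBelow
    refine ⟨a, fun u hu => Set.eq_empty_iff_forall_notMem.2 fun σ hσ => hu ?_⟩
    exact fun i => (ha i ⟨σ, rfl⟩).trans (hσ i)
  full := by
    choose b hb using fun i => (Set.finite_range fun σ => (g σ i : ℤ)).bddAbove
    exact ⟨b, fun u hu => Set.eq_univ_iff_forall.2 fun σ i => (hb i ⟨σ, rfl⟩).trans (hu i)⟩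
  oneCritical σ := by
    refine ⟨g σ, ⟨le_refl (g σ), fun i hi => lt_irrefl _ (Grade.le_sub_e_iff.1 hi).2⟩, fun u hu => ?_⟩
    refine le_antisymm (fun i => ?_) hu.1
    by_contra hi
    exact hu.2 i (Grade.le_sub_e_iff.2 ⟨hu.1, not_le.1 hi⟩)

variable {n : ℕ} (g : K.Cell → Grade n) (hg : ∀ σ τ, K.IsFacet σ τ → g σ ≤ g τ)

lemma mem_ofGrade {u : Grade n} {σ : K.Cell} : σ ∈ ((ofGrade g hg).sub u).cells ↔ g σ ≤ u :=
  Iff.rfl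

lemma mem_ofGrade_and_notMem_previous {u : Grade n} {σ : K.Cell} :
    σ ∈ ((ofGrade g hg).sub u).cells ∧ σ ∉ ((ofGrade g hg).previous u).cells ↔ g σ = u := by
  constructor
  · rintro ⟨h1, h2⟩
    refine le_antisymm h1 fun i => ?_
    by_contra hi
    exact h2 (Set.mem_iUnion.2 ⟨i, Grade.le_sub_e_iff.2 ⟨h1, not_le.1 hi⟩⟩)
  · rintro rfl
    refine ⟨le_refl (g σ), fun h => ?_⟩
    obtain ⟨i, hi⟩ := Set.mem_iUnion.1 h
    exact lt_irrefl _ (Grade.le_sub_e_iff.1 hi).2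

end MultiFiltration

namespace DiscreteVectorField

/-- The discrete vector field without vectors. -/
def empty (K : CellComplex.{u, v} F) : K.DiscreteVectorField where
  pairs := ∅
  isFacet := fun _ _ h => h.elim
  eq_of_fst := fun _ _ _ h => h.elim
  eq_of_snd := fun _ _ _ h => h.elim
  disjoint := fun _ _ _ h => h.elim

lemma isGradient_empty : (empty K).IsGradient := by
  intro σ h
  obtain ⟨_, ⟨_, h1, _⟩, _⟩ := Relation.TransGen.head'_iff.1 h
  exact h1

lemma isConsistent_empty {n : ℕ} (𝒦 : K.MultiFiltration n) : (empty K).IsConsistent 𝒦 :=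
  fun _ _ h => h.elim

lemma isCritical_empty (σ : K.Cell) : (empty K).IsCritical σ :=
  fun _ => ⟨id, id⟩

lemma morseNumber_empty {n : ℕ} (g : K.Cell → Grade n)
    (hg : ∀ σ τ, K.IsFacet σ τ → g σ ≤ g τ) (q : ℤ) (u : Grade n) :
    (empty K).morseNumber (.ofGrade g hg) q u = {σ | K.dim σ = q ∧ g σ = u}.ncard := by
  rw [morseNumber]
  congr 1
  ext σ
  simp only [Set.mem_ofPred_eq, MultiFiltration.mem_ofGrade_and_notMem_previous, isCritical_empty,
    true_and]

/-- If the cells enter at pairwise distinct grades, the empty vector field is relative-perfect. -/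
lemma isRelativePerfect_empty {n : ℕ} (g : K.Cell → Grade n)
    (hg : ∀ σ τ, K.IsFacet σ τ → g σ ≤ g τ) (hinj : Function.Injective g) :
    (empty K).IsRelativePerfect (.ofGrade g hg) := by
  intro q u
  refine le_antisymm ?_
    (isGradient_empty.finrank_relHomology_le_morseNumber (isConsistent_empty _) q u)
  rw [morseNumber_empty]
  by_cases h : ∃ σ, K.dim σ = q ∧ g σ = u
  · obtain ⟨σ, hσ, hσu⟩ := h
    have hX (q' : ℤ) : Module.finrank F ((Subcomplex.relativeChains
        ((MultiFiltration.ofGrade g hg).previous_le u)).X q') =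
        {σ | K.dim σ = q' ∧ g σ = u}.ncard := by
      rw [Subcomplex.finrank_relativeChains]
      congr 1
      ext σ
      rw [Set.mem_ofPred_eq, Set.mem_ofPred_eq, ← MultiFiltration.mem_ofGrade_and_notMem_previous g hg]
      tauto
    -- Only `σ` enters at `u`, so the relative chain groups in the neighbouring degrees vanish and
    -- the class of `σ` survives in homology.
    have h0 (q' : ℤ) (hq' : q' ≠ q) : {σ | K.dim σ = q' ∧ g σ = u}.ncard = 0 := by
      rw [Set.ncard_eq_zero, Set.eq_empty_iff_forall_notMem]
      rintro σ' ⟨h1, h2⟩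
      rw [hinj (h2.trans hσu.symm), hσ] at h1
      exact hq' h1.symm
    have := Subcomplex.finite_relativeChains ((MultiFiltration.ofGrade g hg).previous_le u)
    have key := (Subcomplex.relativeChains
      ((MultiFiltration.ofGrade g hg).previous_le u)).finrank_X_le
      (i := q + 1) (j := q) (k := q - 1) (by simp) (by simp)
    rw [hX, hX, hX, h0 (q + 1) (by omega), h0 (q - 1) (by omega)] at key
    exact key
  · rw [(Set.ncard_eq_zero).2]
    · exact Nat.zero_le _
    · exact Set.eq_empty_iff_forall_notMem.2 fun σ hσ => h ⟨σ, hσ⟩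

end DiscreteVectorField

/-! ### The disc with one vertex, two edges and one face -/

section Disc

variable (F)

/-- The dimensions of the cells of `disc`. -/
def discDim : Fin 4 → ℤ := ![0, 1, 1, 2]

/-- The incidence matrix of `disc`. -/
def discIncidence : Fin 4 → Fin 4 → F :=
  ![![0, 0, 0, 0], ![1, 0, 0, 0], ![1, 0, 0, 0], ![0, 1, -1, 0]]

/-- The Lefschetz complex with a vertex `a`, edges `f` and `g` with boundary `a`, and a face with
boundary `f - g`. -/
def disc : CellComplex.{u, 0} F where
  Cell := Fin 4
  dim := discDim
  dim_nonneg σ := by fin_cases σ <;> simp [discDim]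
  incidence := discIncidence F
  dim_of_incidence τ σ := by
    fin_cases τ <;> fin_cases σ <;> simp [discDim, discIncidence]
  sum_incidence τ σ := by
    rw [Fin.sum_univ_four]
    fin_cases τ <;> fin_cases σ <;> simp [discIncidence]

/-- The grade with the given coordinates. -/
def gradeMk (x y : ℤ) : Grade 2 := fun i => if i = 0 then x else y

@[simp]
lemma gradeMk_zero (x y : ℤ) : gradeMk x y 0 = x :=
  rfl

@[simp]
lemma gradeMk_one (x y : ℤ) : gradeMk x y 1 = y :=
  rfl

/-- The grades at which the cells enter: `(0, 0)` for the vertex, `(1, 0)` and `(0, 1)` for the edges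
and `(k, 1)` for the face. -/
def discGrade (k : ℤ) (σ : Fin 4) : Grade 2 :=
  gradeMk ((![0, 1, 0, k] : Fin 4 → ℤ) σ) ((![0, 0, 1, 1] : Fin 4 → ℤ) σ)

lemma discGrade_mono {k : ℤ} (hk : 1 ≤ k) (σ τ : (disc F).Cell) (h : (disc F).IsFacet σ τ) :
    discGrade k σ ≤ discGrade k τ := by
  replace h : discIncidence F τ σ ≠ 0 := h
  change Fin 4 at σ τ
  rw [Grade.le_iff, Fin.forall_fin_two]
  revert h
  fin_cases τ <;> fin_cases σ <;> simp [discGrade, discIncidence] <;> omega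

/-- The bi-filtration of `disc` by `discGrade k`. -/
def discFiltration {k : ℤ} (hk : 1 ≤ k) : (disc F).MultiFiltration 2 :=
  .ofGrade (discGrade k) (discGrade_mono F hk)

/-- The grade `(1, 1)`. -/
def oneOne : Grade 2 := gradeMk 1 1

lemma mem_discFiltration {k : ℤ} (hk : 1 ≤ k) (u : Grade 2) (σ : (disc F).Cell) :
    σ ∈ ((discFiltration F hk).sub u).cells ↔
      (discGrade k σ 0 : ℤ) ≤ u 0 ∧ (discGrade k σ 1 : ℤ) ≤ u 1 :=
  (MultiFiltration.mem_ofGrade _ _).trans (Grade.le_iff.trans Fin.forall_fin_two)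

variable {k : ℤ} (hk : 1 ≤ k)

lemma exists_isFacet_disc (σ : (disc F).Cell) (h : 0 < (disc F).dim σ) :
    ∃ ρ, (disc F).IsFacet ρ σ := by
  replace h : 0 < discDim σ := h
  change ∃ ρ, discIncidence F σ ρ ≠ 0
  change Fin 4 at σ
  revert h
  fin_cases σ
  · simp [discDim]
  · exact fun _ => ⟨(0 : Fin 4), by simp [discIncidence]⟩
  · exact fun _ => ⟨(0 : Fin 4), by simp [discIncidence]⟩
  · exact fun _ => ⟨(1 : Fin 4), by simp [discIncidence]⟩

/-- At each of (0,1) and (1,0) just one edge is present, and its boundary is nonzero. -/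
lemma finrank_homology_one_disc (i : Fin 2) : Module.finrank F
    (((discFiltration F hk).sub (oneOne - .e i)).chains.homology 1) = 0 := by
  refine Subcomplex.finrank_homology_eq_zero_of_subsingleton _ _ ⟨?_⟩ fun τ =>
    exists_isFacet_disc F _ (by rw [τ.2.2]; exact one_pos)
  rintro ⟨σ, h1, h2⟩ ⟨τ, h3, h4⟩
  refine Subtype.ext ?_
  replace h1 : discGrade k σ ≤ oneOne - .e i := h1
  replace h3 : discGrade k τ ≤ oneOne - .e i := h3
  rw [Grade.le_sub_e_iff, Grade.le_iff, Fin.forall_fin_two] at h1 h3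
  replace h2 : discDim σ = 1 := h2
  replace h4 : discDim τ = 1 := h4
  change Fin 4 at σ τ
  change σ = τ
  revert h1 h2 h3 h4
  fin_cases i <;> fin_cases σ <;> fin_cases τ <;> simp [discGrade, discDim, oneOne]

lemma card_disc_zero (u : Grade 2) :
    Nat.card (((discFiltration F hk).sub u).CellsOfDim 0) ≤ 1 := by
  refine Finite.card_le_one_iff_subsingleton.2 ⟨?_⟩
  rintro ⟨σ, h1, h2⟩ ⟨τ, h3, h4⟩
  refine Subtype.ext ?_
  replace h2 : discDim σ = 0 := h2
  replace h4 : discDim τ = 0 := h4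
  change Fin 4 at σ τ
  change σ = τ
  revert h2 h4
  fin_cases σ <;> fin_cases τ <;> simp [discDim]

lemma finrank_homology_zero_disc (u : Grade 2) :
    Module.finrank F (((discFiltration F hk).sub u).chains.homology 0) ≤ 1 := by
  have := Subcomplex.finite_chains ((discFiltration F hk).sub u) 0
  refine (HomologicalComplex.finrank_homology_le_finrank_X _ _).trans ?_
  rw [Subcomplex.finrank_chains]
  exact card_disc_zero F hk u

lemma finrank_homology_two_disc (u : Grade 2) :
    Module.finrank F (((discFiltration F hk).sub u).chains.homology 2) = 0 := by
  refine Subcomplex.finrank_homology_eq_zero_of_subsingleton _ _ ⟨?_⟩ fun τ =>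
    exists_isFacet_disc F _ (by rw [τ.2.2]; exact two_pos)
  rintro ⟨σ, h1, h2⟩ ⟨τ, h3, h4⟩
  refine Subtype.ext ?_
  replace h2 : discDim σ = 2 := h2
  replace h4 : discDim τ = 2 := h4
  change Fin 4 at σ τ
  change σ = τ
  revert h2 h4
  fin_cases σ <;> fin_cases τ <;> simp [discDim]

/-- For `k > 1` the face is absent at (1,1), leaving two edges and at most one vertex: dim H₁ ≥ 2 -
1. -/
lemma one_le_finrank_homology_one_disc (hk' : 1 < k) :
    1 ≤ Module.finrank F (((discFiltration F hk).sub oneOne).chains.homology 1) := by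
  have := Subcomplex.finite_chains ((discFiltration F hk).sub oneOne)
  have key := ((discFiltration F hk).sub oneOne).chains.finrank_X_le
    (i := 2) (j := 1) (k := 0) (by simp) (by simp)
  simp only [Subcomplex.finrank_chains] at key
  have h0 := card_disc_zero F hk oneOne
  have h1 : 2 ≤ Nat.card (((discFiltration F hk).sub oneOne).CellsOfDim 1) := by
    let f : Fin 2 → ((discFiltration F hk).sub oneOne).CellsOfDim 1 :=
      ![⟨(1 : Fin 4), (mem_discFiltration F hk _ _).2 (by simp [discGrade, oneOne]), rfl⟩,
        ⟨(2 : Fin 4), (mem_discFiltration F hk _ _).2 (by simp [discGrade, oneOne]), rfl⟩]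
    have hf : Function.Injective f := by
      intro x y hxy
      replace hxy := congrArg (fun z => (z.1 : Fin 4)) hxy
      revert hxy
      fin_cases x <;> fin_cases y <;> simp [f]
    simpa using Nat.card_le_card_of_injective f hf
  have h2 : Nat.card (((discFiltration F hk).sub oneOne).CellsOfDim 2) = 0 := by
    refine Finite.card_eq_zero_iff.2 ⟨?_⟩
    rintro ⟨σ, h1, h2⟩
    rw [mem_discFiltration] at h1
    replace h2 : discDim σ = 2 := h2
    change Fin 4 at σ
    revert h1 h2
    fin_cases σ <;> simp [discDim, discGrade, oneOne, hk']
  omega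

/-- The relations between the Betti tables of `disc` and the dimensions of its homology. -/
lemma betti_disc :
    (discFiltration F hk).betti 0 1 oneOne =
      Module.finrank F (((discFiltration F hk).sub oneOne).chains.homology 1) ∧
    (discFiltration F hk).betti 1 1 oneOne = 0 ∧
    (discFiltration F hk).betti 0 2 oneOne = 0 ∧
    (discFiltration F hk).betti 2 0 oneOne ≤ 1 := by
  have h0 := ((discFiltration F hk).betti_add_rank 0 oneOne).2.2
  have h1 := (discFiltration F hk).betti_add_rank 1 oneOne
  have h2 := ((discFiltration F hk).betti_add_rank 2 oneOne).1
  have e0 := finrank_homology_zero_disc F hk (oneOne - .e 0 - .e 1)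
  have e1 := finrank_homology_one_disc F hk 0
  have e1' := finrank_homology_one_disc F hk 1
  have e2 := finrank_homology_two_disc F hk oneOne
  -- H₁ vanishes at both predecessors of (1,1), which kills ξ_1^1 and the rank into H₁, so ξ_0^1 is
  -- all of H₁.
  refine ⟨?_, ?_, ?_, ?_⟩ <;> omega

lemma discGrade_injective : Function.Injective (discGrade 1) := by
  intro σ τ h
  have h0 : (discGrade 1 σ 0 : ℤ) = discGrade 1 τ 0 := congrFun h 0
  have h1 : (discGrade 1 σ 1 : ℤ) = discGrade 1 τ 1 := congrFun h 1
  revert h0 h1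
  fin_cases σ <;> fin_cases τ <;> simp [discGrade]

end Disc

end CellComplex

/-! ### The inequalities and their sharpness -/

open CellComplex in
theorem corollary4p4 (F : Type u) [Field F] :
    -- the two inequalities
    (∀ (K : CellComplex.{u, v} F) (𝒦 : K.MultiFiltration 2) (V : K.DiscreteVectorField),
      V.IsGradient → V.IsConsistent 𝒦 →
        (∀ (q : ℤ) (u : Grade 2),
          (V.morseNumber 𝒦 q u : ℤ) ≥
            (𝒦.betti 0 q u : ℤ) + 𝒦.betti 1 (q - 1) u - 𝒦.betti 2 (q - 1) u) ∧
        (V.IsRelativePerfect 𝒦 → ∀ (q : ℤ) (u : Grade 2),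
          V.morseNumber 𝒦 q u ≤
            𝒦.betti 0 q u + 𝒦.betti 1 (q - 1) u + 𝒦.betti 2 (q - 2) u)) ∧
    -- sharpness of the first inequality
    (∃ (K : CellComplex.{u, 0} F) (𝒦 : K.MultiFiltration 2) (V : K.DiscreteVectorField),
      V.IsGradient ∧ V.IsConsistent 𝒦 ∧ ∃ (q : ℤ) (u : Grade 2),
        𝒦.betti 2 (q - 1) u ≠ 0 ∧
        (V.morseNumber 𝒦 q u : ℤ) =
          (𝒦.betti 0 q u : ℤ) + 𝒦.betti 1 (q - 1) u - 𝒦.betti 2 (q - 1) u) ∧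
    -- sharpness of the second inequality
    (∃ (K : CellComplex.{u, 0} F) (𝒦 : K.MultiFiltration 2) (V : K.DiscreteVectorField),
      V.IsGradient ∧ V.IsConsistent 𝒦 ∧ V.IsRelativePerfect 𝒦 ∧ ∃ (q : ℤ) (u : Grade 2),
        𝒦.betti 2 (q - 2) u ≠ 0 ∧
        V.morseNumber 𝒦 q u =
          𝒦.betti 0 q u + 𝒦.betti 1 (q - 1) u + 𝒦.betti 2 (q - 2) u) := by
  refine ⟨fun K 𝒦 V hV hK => ⟨fun q u => ?_, fun hP q u => ?_⟩, ?_, ?_⟩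
  · have h1 := (𝒦.finrank_relHomology_bounds q u).1
    have h2 := hV.finrank_relHomology_le_morseNumber hK q u
    omega
  · rw [hP q u]
    exact (𝒦.finrank_relHomology_bounds q u).2
  -- With `k = 2` no cell enters at (1,1), yet a 1-cycle is born there. The lower bound for `q = 1`
  -- then gives 1 ≤ ξ_0^1 + ξ_1^0 ≤ ξ_2^0 ≤ 1, so equality holds throughout with Morse number zero.
  · have hk : (1 : ℤ) ≤ 2 := one_le_two
    have hm : (DiscreteVectorField.empty (disc F)).morseNumber (discFiltration F hk) 1 oneOne =
        0 := by
      refine (DiscreteVectorField.morseNumber_empty _ _ _ _).trans ?_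
      rw [Set.ncard_eq_zero, Set.eq_empty_iff_forall_notMem]
      rintro σ ⟨h1, h2⟩
      have h3 : (discGrade 2 σ 0 : ℤ) = 1 := congrFun h2 0
      have h4 : (discGrade 2 σ 1 : ℤ) = 1 := congrFun h2 1
      replace h1 : discDim σ = 1 := h1
      change Fin 4 at σ
      revert h1 h3 h4
      fin_cases σ <;> simp [discGrade, discDim]
    obtain ⟨h1, -, -, h4⟩ := betti_disc F hk
    have h5 := one_le_finrank_homology_one_disc F hk one_lt_two
    have h6 := ((discFiltration F hk).finrank_relHomology_bounds 1 oneOne).1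
    have h7 := DiscreteVectorField.isGradient_empty.finrank_relHomology_le_morseNumber
      (DiscreteVectorField.isConsistent_empty (discFiltration F hk)) 1 oneOne
    rw [sub_self] at h6
    refine ⟨disc F, discFiltration F hk, .empty _, DiscreteVectorField.isGradient_empty,
      DiscreteVectorField.isConsistent_empty _, 1, oneOne, ?_⟩
    rw [sub_self]
    omega
  -- With `k = 1` the four cells enter at the four corners of a square, so the empty field is
  -- relative-perfect. For `q = 2` the face counts 1, while ξ_0^2 = ξ_1^1 = 0 and ξ_2^0 ≤ 1; the
  -- upper bound forces ξ_2^0 = 1.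
  · have hk : (1 : ℤ) ≤ 1 := le_rfl
    have hP : (DiscreteVectorField.empty (disc F)).IsRelativePerfect (discFiltration F hk) :=
      DiscreteVectorField.isRelativePerfect_empty _ _ discGrade_injective
    have hm : (DiscreteVectorField.empty (disc F)).morseNumber (discFiltration F hk) 2 oneOne =
        1 := by
      refine (DiscreteVectorField.morseNumber_empty _ _ _ _).trans ?_
      refine Set.ncard_eq_one.2 ⟨(3 : Fin 4), ?_⟩
      ext σ
      refine ⟨fun h => discGrade_injective (h.2.trans rfl), ?_⟩
      rintro rfl
      exact ⟨rfl, rfl⟩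
    obtain ⟨-, h2, h3, h4⟩ := betti_disc F hk
    have h6 := ((discFiltration F hk).finrank_relHomology_bounds 2 oneOne).2
    have h7 := hP 2 oneOne
    refine ⟨disc F, discFiltration F hk, .empty _, DiscreteVectorField.isGradient_empty,
      DiscreteVectorField.isConsistent_empty _, hP, 2, oneOne, ?_⟩
    rw [show (2 : ℤ) - 1 = 1 from rfl, sub_self] at *
    omega
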